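/- Let $v:[0,\infty)\to\mathbb{R}$ be bounded and Lipschitz with Lipschitz constant $L$. Let $\alpha,\beta\in\mathbb{R}$ and let $w:\mathbb{R}\to[0,\infty)$ vanish outside $[\alpha,\beta]$, have bounded variation on $[\alpha,\beta]$, and satisfy $\int_\alpha^\beta w(x)\,dx=1$; let $TV(w)$ be the total variation of $w$ on $\mathbb{R}$ (so the jumps at $\alpha,\beta$ count). Let $X=L^\infty\cap\mathcal{P}^{ac}_c(\mathbb{R})$ be the set of compactly supported Borel probability measures on $\mathbb{R}$ that are absolutely continuous with respect to Lebesgue measure with essentially bounded density (a measure is identified with its density), endowed with the distance $$W_\infty(\mu,\nu)=\inf_{\pi}\ \pi\text{-}\mathrm{ess\,sup}\,|x-y|,$$ where $\pi$ ranges over the Borel measures on $\mathbb{R}^2$ with marginals $\mu$ and $\nu$. Let $\rho_0\in X$. For $\mu\in X$ put $V[\mu](x)=v\left(\int w(y-x)\,d\mu(y)\right)$. A weak solution on $[0,T]$ of $$\partial_t\rho+\partial_x\big(V[\rho(t)]\,\rho\big)=0,\qquad \rho(0)=\rho_0, \tag{1}$$ is a curve $\rho\in C^0([0,T],X)$ with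 $\rho(0)=\rho_0$ such that for all $\varphi\in C_c^\infty((0,T)\times\mathbb{R})$ $$\int_0^T\int_{\mathbb{R}}\big(\partial_t\varphi(t,x)+V[\rho(t)](x)\,\partial_x\varphi(t,x)\big)\,d\rho(t)(x)\,dt=0 .$$ Then there is $T>0$ such that for every $t\in(0,T)$ problem (1) has exactly one weak solution on $[0,t]$. Moreover, for every $T>0$ with $T\,e\,L\,TV(w)\,\|\rho_0\|_{L^\infty}<1$: (a) problem (1) has exactly one weak solution $\rho$ on $[0,T]$; (b) there are Euler trajectories $\rho^n\in C^0([0,T],X)$, $n\in\mathbb{N}$, given by $\rho^n(0)=\rho_0$ and $$\rho^n(k2^{-n}T+t)=\phi^{n,k}_t\,\#\,\rho^n(k2^{-n}T),\qquad t\in[0,2^{-n}T],\ k=0,\dots,2^n-1,$$ where $\phi^{n,k}_t$ is the flow of the vector field $V[\rho^n(k2^{-n}T)]$ and $\#$ denotes push-forward, and a subsequence $(\rho^{n_j})_j$ with $\sup_{t\in[0,T]}W_\infty(\rho^{n_j}(t),\rho(t))\to0$ as $j\to\infty$. -/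

import Mathlib

open MeasureTheory Set Filter Topology
open scoped ENNReal NNReal

namespace NonlocalTransport

/-- `π` is a transference plan from `μ` to `ν`: its marginals are `μ` and `ν`. -/
def IsPlan (π : Measure (ℝ × ℝ)) (μ ν : Measure ℝ) : Prop :=
  π.map Prod.fst = μ ∧ π.map Prod.snd = ν

/-- The `∞`-Wasserstein distance: the infimum over all transference plans `π` of the
`π`-essential supremum of `|x - y|`. -/
noncomputable def Winf (μ ν : Measure ℝ) : ℝ≥0∞ :=
  ⨅ (π : Measure (ℝ × ℝ)) (_ : IsPlan π μ ν), essSup (fun p : ℝ × ℝ => edist p.1 p.2) π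

/-- The `L^∞` norm of the Lebesgue density of `μ`. -/
noncomputable def linfNorm (μ : Measure ℝ) : ℝ≥0∞ :=
  essSup (μ.rnDeriv volume) volume

/-- `L^∞ ∩ 𝒫^{ac}_c(ℝ)`: compactly supported probability measures that are absolutely
continuous with respect to the Lebesgue measure and have an essentially bounded density. -/
structure IsBddDensity (μ : Measure ℝ) : Prop where
  prob : IsProbabilityMeasure μ
  compact_supp : ∃ S : Set ℝ, IsCompact S ∧ μ Sᶜ = 0
  ac : μ ≪ volume
  bdd : linfNorm μ < ∞

/-- `C^0([0,T], L^∞ ∩ 𝒫^{ac}_c(ℝ))`, the target being endowed with the distance `Winf`.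
Only the values of the curve on `[0,T]` matter. -/
structure IsContCurve (T : ℝ) (ρ : ℝ → Measure ℝ) : Prop where
  mem : ∀ t ∈ Icc 0 T, IsBddDensity (ρ t)
  cont : ∀ s ∈ Icc 0 T, Tendsto (fun t => Winf (ρ s) (ρ t)) (𝓝[Icc 0 T] s) (𝓝 0)

/-- The velocity field `V[μ](x) = v (∫ w(y - x) dμ(y))`. -/
noncomputable def velocity (v w : ℝ → ℝ) (μ : Measure ℝ) (x : ℝ) : ℝ :=
  v (∫ y, w (y - x) ∂μ)

/-- Test functions `φ ∈ C_c^∞((0,T) × ℝ)`. -/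
structure IsTestFun (T : ℝ) (φ : ℝ × ℝ → ℝ) : Prop where
  smooth : ContDiff ℝ ((⊤ : ℕ∞) : WithTop ℕ∞) φ
  compact : HasCompactSupport φ
  supp : tsupport φ ⊆ Ioo 0 T ×ˢ univ

/-- `ρ ∈ C^0([0,T], L^∞ ∩ 𝒫^{ac}_c(ℝ))` is a weak solution on `[0,T]` of the Cauchy problem
`∂ₜρ + ∂ₓ(V[ρ(t)] ρ) = 0`, `ρ(0) = ρ₀`. -/
structure IsWeakSolution (v w : ℝ → ℝ) (ρ₀ : Measure ℝ) (T : ℝ) (ρ : ℝ → Measure ℝ) :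
    Prop where
  curve : IsContCurve T ρ
  init : ρ 0 = ρ₀
  weak : ∀ φ : ℝ × ℝ → ℝ, IsTestFun T φ →
    ∫ t in (0 : ℝ)..T, ∫ x, (deriv (fun s => φ (s, x)) t
      + velocity v w (ρ t) x * deriv (fun z => φ (t, z)) x) ∂(ρ t) = 0

/-- There is one and, as a curve on `[0,T]`, only one weak solution. -/
def ExistsUniqueWeakSolution (v w : ℝ → ℝ) (ρ₀ : Measure ℝ) (T : ℝ) : Prop :=
  (∃ ρ : ℝ → Measure ℝ, IsWeakSolution v w ρ₀ T ρ) ∧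
    ∀ ρ ρ' : ℝ → Measure ℝ, IsWeakSolution v w ρ₀ T ρ → IsWeakSolution v w ρ₀ T ρ' →
      ∀ t ∈ Icc 0 T, ρ t = ρ' t

/-- `Φ t x`, for `t ∈ [0,h]`, is the flow of the autonomous vector field `V`. -/
def IsFlow (V : ℝ → ℝ) (h : ℝ) (Φ : ℝ → ℝ → ℝ) : Prop :=
  ∀ x : ℝ, Φ 0 x = x ∧
    ∀ t ∈ Icc 0 h, HasDerivWithinAt (fun s => Φ s x) (V (Φ t x)) (Icc 0 h) t

/-- `r` is the `n`-th Euler trajectory on `[0,T]`: it starts from `ρ₀` and on each of the `2^n`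
time steps of length `2^{-n}T` it is pushed forward by the flow of the velocity field frozen at
the beginning of the step. -/
def IsEulerTrajectory (v w : ℝ → ℝ) (ρ₀ : Measure ℝ) (T : ℝ) (n : ℕ) (r : ℝ → Measure ℝ) :
    Prop :=
  r 0 = ρ₀ ∧ ∀ k : ℕ, k < 2 ^ n → ∃ Φ : ℝ → ℝ → ℝ,
    IsFlow (velocity v w (r (k * (T / 2 ^ n)))) (T / 2 ^ n) Φ ∧
      ∀ t ∈ Icc 0 (T / 2 ^ n),
        r (k * (T / 2 ^ n) + t) = (r (k * (T / 2 ^ n))).map (Φ t)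

end NonlocalTransport

/-! The velocity sees a measure only through its distribution function: since `w` has bounded
variation, `∫ w (y - x) dμ` moves by at most `TV(w)` times the uniform distance of distribution
functions (`abs_integral_sub_le_of_boundedVariation`). Put `c = L * TV(w)`. If `μ` has density at
most `M`, then `V[μ]` is `c * M`-Lipschitz in space, and for two push-forwards of one measure with
densities at most `M` by maps within `d` of each other, the fields differ by at most `c * M * d`.

The solution is sought as `ρ(t) = X t # ρ₀` with increasing bi-Lipschitz maps `X t`; such a
push-forward multiplies the density bound by at most the bi-Lipschitz constant. An Euler step of
length `h` turns a density bound `M` into `M * exp (c * M * h)`, which stays below the solution `a /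
(1 - c * a * t)` of `M' = c * M ^ 2`, `M(0) = a` (`inv_mul_exp_le`). So `c * a * T < 1` gives one
constant `κ` for all Euler maps, whatever the step. A Grönwall argument in the supremum norm
(`IsApproxFlow.abs_sub_le`) makes the Euler maps uniformly Cauchy, and their limit solves `∂ₜX = V[X
# ρ₀](X)`; integrating test functions along its trajectories shows that it gives a weak solution.
The whole Euler sequence converges, with error `O(2⁻ⁿ)`.

For uniqueness, an arbitrary weak solution, with no density bound uniform in time, is compared with
`X # ρ₀` through distribution functions. The fronts `X s x ± r s`, with `r` growing fast enough,
outrun the field of the weak solution on one side and lag behind it on the other, so mass crosses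
them in one direction only. This traps the distribution function of the weak solution between shifts
of that of `X # ρ₀`. An a priori distance `E` thereby improves to `E / 2 + η`
(`IsLagrangianSolution.abs_real_Iic_sub_le`), and iteration forces equality. -/

namespace NonlocalTransport

/-! ### Measures with bounded density -/

/-- `μ` is absolutely continuous with density at most `M`. -/
def DensityLE (M : ℝ) (μ : Measure ℝ) : Prop := μ ≤ ENNReal.ofReal M • volume

lemma DensityLE.absolutelyContinuous {M : ℝ} {μ : Measure ℝ} (h : DensityLE M μ) :
    μ ≪ volume :=
  (Measure.absolutelyContinuous_of_le h).trans (Measure.smul_absolutelyContinuous)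

lemma DensityLE.linfNorm_le {M : ℝ} {μ : Measure ℝ} (h : DensityLE M μ) :
    linfNorm μ ≤ ENNReal.ofReal M := by
  refine essSup_le_of_ae_le _ ?_
  refine ae_le_of_forall_setLIntegral_le_of_sigmaFinite (μ.measurable_rnDeriv volume)
    fun s hs _ => ?_
  calc ∫⁻ x in s, μ.rnDeriv volume x ≤ μ s := Measure.setLIntegral_rnDeriv_le s
    _ ≤ _ := by simpa using h s

lemma densityLE_of_linfNorm_le {μ : Measure ℝ} [SigmaFinite μ] {M : ℝ} (hac : μ ≪ volume)
    (hM : linfNorm μ ≤ ENNReal.ofReal M) : DensityLE M μ := by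
  refine Measure.le_iff.2 fun s hs => ?_
  rw [← Measure.setLIntegral_rnDeriv hac s]
  calc ∫⁻ x in s, μ.rnDeriv volume x ≤ ∫⁻ _ in s, ENNReal.ofReal M := by
        refine lintegral_mono_ae (ae_restrict_of_ae ?_)
        filter_upwards [ENNReal.ae_le_essSup (μ := volume) (μ.rnDeriv volume)] with x hx
        exact hx.trans hM
    _ = _ := by simp

lemma IsBddDensity.densityLE {μ : Measure ℝ} (h : IsBddDensity μ) :
    DensityLE (linfNorm μ).toReal μ := by
  have := h.prob
  exact densityLE_of_linfNorm_le h.ac (by rw [ENNReal.ofReal_toReal h.bdd.ne])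

lemma isBddDensity_of_densityLE {μ : Measure ℝ} [IsProbabilityMeasure μ] {M : ℝ}
    (hM : DensityLE M μ) {S : Set ℝ} (hS : IsCompact S) (h : μ Sᶜ = 0) : IsBddDensity μ :=
  ⟨inferInstance, ⟨S, hS, h⟩, hM.absolutelyContinuous,
    hM.linfNorm_le.trans_lt ENNReal.ofReal_lt_top⟩

lemma DensityLE.real_Iic_le {M : ℝ} (hM : 0 ≤ M) {μ : Measure ℝ} [IsFiniteMeasure μ]
    (h : DensityLE M μ) {x y : ℝ} (hxy : x ≤ y) :
    μ.real (Iic y) ≤ μ.real (Iic x) + M * (y - x) := by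
  have h1 : μ (Ioc x y) ≤ ENNReal.ofReal (M * (y - x)) := by
    have := h (Ioc x y)
    simpa [Real.volume_Ioc, ENNReal.ofReal_mul hM] using this
  rw [← Iic_union_Ioc_eq_Iic hxy]
  refine (measureReal_union_le _ _).trans ?_
  gcongr
  exact ENNReal.toReal_le_of_le_ofReal (mul_nonneg hM (sub_nonneg.2 hxy)) h1

lemma DensityLE.pos {M : ℝ} {μ : Measure ℝ} [IsProbabilityMeasure μ] (h : DensityLE M μ) :
    0 < M := by
  by_contra! hM
  have := h univ
  simp [ENNReal.ofReal_of_nonpos hM] at this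

/-- Lebesgue measure is one-dimensional Hausdorff measure, which grows by a factor at most `K` under
preimages by a `K`-antilipschitz map. -/
lemma DensityLE.map_of_antilipschitz {M : ℝ} {μ : Measure ℝ} (h : DensityLE M μ) {K : ℝ≥0}
    {f : ℝ → ℝ} (hf : Measurable f) (hK : AntilipschitzWith K f) :
    DensityLE (M * K) (μ.map f) := by
  refine Measure.le_iff.2 fun s hs => ?_
  rw [Measure.map_apply hf hs]
  refine (h _).trans ?_
  have := hK.hausdorffMeasure_preimage_le zero_le_one s
  rw [hausdorffMeasure_real] at this
  simp only [Measure.smul_apply, smul_eq_mul]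
  rw [ENNReal.ofReal_mul' K.coe_nonneg, mul_assoc]
  gcongr
  simpa using this

/-! ### Integrals of functions of bounded variation against two measures -/

/-- An upper set of the line is empty, everything, or a half-line; whether the endpoint belongs to
it is irrelevant for absolutely continuous measures. -/
lemma abs_real_sub_le_of_isUpperSet {μ ν : Measure ℝ} [IsProbabilityMeasure μ]
    [IsProbabilityMeasure ν] (hμ : μ ≪ volume) (hν : ν ≪ volume) {D : ℝ}
    (hD : ∀ s, |μ.real (Iic s) - ν.real (Iic s)| ≤ D) {A : Set ℝ} (hA : IsUpperSet A) :
    |μ.real A - ν.real A| ≤ D := by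
  have hD0 : 0 ≤ D := (abs_nonneg _).trans (hD 0)
  rcases A.eq_empty_or_nonempty with rfl | ⟨a, ha⟩
  · simpa using hD0
  by_cases hb : BddBelow A
  · have h1 : A =ᵐ[volume] Ioi (sInf A) := by
      have hsub : Ioi (sInf A) ⊆ A := fun x hx => by
        obtain ⟨y, hy, hyx⟩ := exists_lt_of_csInf_lt ⟨a, ha⟩ hx
        exact hA hyx.le hy
      have hsup : A ⊆ Ici (sInf A) := fun x hx => csInf_le hb hx
      exact (hsup.eventuallyLE.trans Ioi_ae_eq_Ici.symm.le).antisymm hsub.eventuallyLE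
    rw [measureReal_congr (hμ.ae_eq h1), measureReal_congr (hν.ae_eq h1), ← compl_Iic,
      measureReal_compl measurableSet_Iic, measureReal_compl measurableSet_Iic]
    simpa [abs_sub_comm] using hD (sInf A)
  · have : A = univ := eq_univ_of_forall fun x => by
      obtain ⟨y, hy, hyx⟩ := not_bddBelow_iff.1 hb x
      exact hA hyx.le hy
    simpa [this] using hD0

/-- Layer-cake formula: `p` minus its infimum takes values in `[0, R]`, and its superlevel sets are
upper sets, so the two integrands over `[0, R]` differ by at most `D`. -/
lemma abs_integral_sub_le_of_monotone {μ ν : Measure ℝ} [IsProbabilityMeasure μ]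
    [IsProbabilityMeasure ν] (hμ : μ ≪ volume) (hν : ν ≪ volume) {D : ℝ}
    (hD : ∀ s, |μ.real (Iic s) - ν.real (Iic s)| ≤ D) {p : ℝ → ℝ} (hp : Monotone p) {R : ℝ}
    (hR : ∀ x y, p y - p x ≤ R) :
    |∫ y, p y ∂μ - ∫ y, p y ∂ν| ≤ R * D := by
  have hR0 : 0 ≤ R := by simpa using hR 0 0
  have hbdd : BddBelow (range p) := ⟨p 0 - R, by rintro _ ⟨x, rfl⟩; linarith [hR x 0]⟩
  set m := ⨅ x, p x
  set f : ℝ → ℝ := fun x => p x - m with hf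
  have hf0 : ∀ x, 0 ≤ f x := fun x => sub_nonneg.2 (ciInf_le hbdd x)
  have hfR : ∀ x, f x ≤ R := fun x => by
    have : p x - R ≤ m := le_ciInf fun y => by linarith [hR y x]
    simp only [hf]; linarith
  have hfm : Measurable f := hp.measurable.sub_const m
  have hfi : ∀ κ : Measure ℝ, IsProbabilityMeasure κ → Integrable f κ := fun κ _ =>
    Integrable.of_bound hfm.aestronglyMeasurable R
      (ae_of_all _ fun x => by rw [Real.norm_eq_abs, abs_of_nonneg (hf0 x)]; exact hfR x)
  have hpi : ∀ κ : Measure ℝ, IsProbabilityMeasure κ →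
      ∫ y, p y ∂κ = (∫ t in Ioc 0 R, κ.real {a | t ≤ f a}) + m := fun κ _ => by
    rw [← (hfi κ inferInstance).integral_eq_integral_Ioc_meas_le (ae_of_all _ hf0)
      (ae_of_all _ hfR)]
    have : p = fun x => f x + m := by ext x; simp [hf]
    rw [this, integral_add (hfi κ inferInstance) (integrable_const m)]
    simp
  have hint : ∀ κ : Measure ℝ, IsProbabilityMeasure κ →
      IntegrableOn (fun t => κ.real {a | t ≤ f a}) (Ioc 0 R) := fun κ _ => by
    have hanti : Antitone (fun t => κ.real {a | t ≤ f a}) := fun s t hst =>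
      measureReal_mono fun a ha => hst.trans ha
    exact Integrable.of_bound hanti.measurable.aestronglyMeasurable 1
      (ae_of_all _ fun t => by
        rw [Real.norm_eq_abs, abs_of_nonneg measureReal_nonneg]; exact measureReal_le_one)
  rw [hpi μ inferInstance, hpi ν inferInstance, add_sub_add_right_eq_sub,
    ← integral_sub (hint μ inferInstance) (hint ν inferInstance)]
  have := norm_setIntegral_le_of_norm_le_const (μ := volume) (s := Ioc 0 R) (C := D)
    (f := fun t => μ.real {a | t ≤ f a} - ν.real {a | t ≤ f a}) (by simp)
    (fun t _ => abs_real_sub_le_of_isUpperSet hμ hν hD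
      fun a b hab ha => le_trans ha (sub_le_sub_right (hp hab) m))
  simpa [hR0, mul_comm] using this

/-- On the two outer half-lines `w` vanishes except possibly at the endpoint, where it is
nonnegative, so it is monotone there and contributes only the jump. -/
lemma boundedVariationOn_univ {w : ℝ → ℝ} {α β : ℝ} (hw : BoundedVariationOn w (Icc α β))
    (h0 : ∀ x, 0 ≤ w x) (hz : ∀ x, x ∉ Icc α β → w x = 0) (hαβ : α ≤ β) :
    BoundedVariationOn w univ := by
  have h1 : BoundedVariationOn w (Iic α) := by
    refine MonotoneOn.boundedVariationOn (C := w α) (fun x hx y hy hxy => ?_) fun x hx => ?_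
    · rcases eq_or_lt_of_le hxy with rfl | h
      · rfl
      · rw [hz x fun h' => absurd (h.trans_le hy) (not_lt.2 h'.1)]
        exact h0 y
    · rw [abs_of_nonneg (h0 x)]
      rcases eq_or_lt_of_le (mem_Iic.1 hx) with rfl | h
      · rfl
      · rw [hz x fun h' => absurd h (not_lt.2 h'.1)]
        exact h0 _
  have h2 : BoundedVariationOn w (Ici β) := by
    have : MonotoneOn (fun x => - w x) (Ici β) := fun x hx y hy hxy => by
      rcases eq_or_lt_of_le hxy with rfl | h
      · rfl
      · simp only
        rw [hz y fun h' => absurd (lt_of_le_of_lt hx h) (not_lt.2 h'.2)]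
        simpa using h0 x
    have h3 : BoundedVariationOn (fun x => - w x) (Ici β) :=
      this.boundedVariationOn (C := w β) fun x hx => by
        rw [abs_neg, abs_of_nonneg (h0 x)]
        rcases eq_or_lt_of_le (mem_Ici.1 hx) with rfl | h
        · rfl
        · rw [hz x fun h' => absurd h (not_lt.2 h'.2)]
          exact h0 _
    have h4 : eVariationOn (fun x => - w x) (Ici β) = eVariationOn w (Ici β) := by
      simp [eVariationOn, edist_neg_neg]
    rwa [BoundedVariationOn, h4] at h3
  have hu : eVariationOn w univ ≤ eVariationOn w (Iic α) + (eVariationOn w (Icc α β)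
      + eVariationOn w (Ici β)) := by
    rw [← eVariationOn.union w (x := β) (isGreatest_Icc hαβ) isLeast_Ici,
      Icc_union_Ici_eq_Ici hαβ, ← eVariationOn.union w isGreatest_Iic isLeast_Ici,
      Iic_union_Ici]
  exact ne_top_of_le_ne_top (ENNReal.add_ne_top.2 ⟨h1, ENNReal.add_ne_top.2 ⟨hw, h2⟩⟩) hu

/-- Jordan decomposition: `w` is half the difference of the monotone functions `V + w` and `V - w`,
with `V` the variation from `0`. -/
lemma abs_integral_sub_le_of_boundedVariation {μ ν : Measure ℝ} [IsProbabilityMeasure μ]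
    [IsProbabilityMeasure ν] (hμ : μ ≪ volume) (hν : ν ≪ volume) {D : ℝ}
    (hD : ∀ s, |μ.real (Iic s) - ν.real (Iic s)| ≤ D) {w : ℝ → ℝ} {α β : ℝ}
    (hw : BoundedVariationOn w univ) (hz : ∀ x, x ∉ Icc α β → w x = 0) :
    |∫ y, w y ∂μ - ∫ y, w y ∂ν| ≤ (eVariationOn w univ).toReal * D := by
  set TV := (eVariationOn w univ).toReal
  set V := variationOnFromTo w univ 0
  have hadd : Monotone (V + w) := monotoneOn_univ.1
    (variationOnFromTo.add_self_monotoneOn hw.locallyBoundedVariationOn (mem_univ 0))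
  have hsub : Monotone (V - w) := monotoneOn_univ.1
    (variationOnFromTo.sub_self_monotoneOn hw.locallyBoundedVariationOn (mem_univ 0))
  have hV : ∀ x y, V y - V x ≤ TV := fun x y => by
    simp only [V]
    rw [variationOnFromTo.sub_right hw.locallyBoundedVariationOn (mem_univ _) (mem_univ _)
      (mem_univ _)]
    exact (le_abs_self _).trans (variationOnFromTo.abs_le_eVariationOn hw)
  have hlo : ∀ x, w (min x (α - 1)) = 0 := fun x => hz _ fun h => by
    have := h.1.trans (min_le_right _ _); linarith
  have hhi : ∀ x, w (max x (β + 1)) = 0 := fun x => hz _ fun h => by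
    have := (le_max_right _ _).trans h.2; linarith
  -- Widening the interval beyond `[α, β]` makes `w` vanish at both ends, so the oscillation is that
  -- of `V` alone. This gives the constant `TV` rather than `2 * TV`.
  have hRadd : ∀ x y, (V + w) y - (V + w) x ≤ TV := fun x y => by
    have h1 := hadd (min_le_left x (α - 1))
    have h2 := hadd (le_max_left y (β + 1))
    have h3 := hV (min x (α - 1)) (max y (β + 1))
    simp only [Pi.add_apply, hlo, hhi] at *
    linarith
  have hRsub : ∀ x y, (V - w) y - (V - w) x ≤ TV := fun x y => by
    have h1 := hsub (min_le_left x (α - 1))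
    have h2 := hsub (le_max_left y (β + 1))
    have h3 := hV (min x (α - 1)) (max y (β + 1))
    simp only [Pi.sub_apply, hlo, hhi] at *
    linarith
  have hint : ∀ κ : Measure ℝ, IsProbabilityMeasure κ → ∀ p : ℝ → ℝ, Monotone p →
      (∀ x y, p y - p x ≤ TV) → Integrable p κ := fun κ _ p hp hp' =>
    Integrable.of_bound hp.measurable.aestronglyMeasurable (|p 0| + TV) (ae_of_all _ fun x => by
      have h1 := hp' 0 x
      have h2 := hp' x 0
      rw [Real.norm_eq_abs, abs_le]
      constructor <;> linarith [neg_abs_le (p 0), le_abs_self (p 0)])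
  have key : ∀ κ : Measure ℝ, IsProbabilityMeasure κ →
      ∫ y, w y ∂κ = (∫ y, (V + w) y ∂κ - ∫ y, (V - w) y ∂κ) / 2 := fun κ _ => by
    rw [← integral_sub (hint κ inferInstance _ hadd hRadd) (hint κ inferInstance _ hsub hRsub),
      ← integral_div]
    refine integral_congr_ae (ae_of_all _ fun x => ?_)
    simp only [Pi.add_apply, Pi.sub_apply]
    ring
  have h1 := abs_integral_sub_le_of_monotone hμ hν hD hadd hRadd
  have h2 := abs_integral_sub_le_of_monotone hμ hν hD hsub hRsub
  rw [key μ inferInstance, key ν inferInstance]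
  rw [abs_le] at *
  constructor <;> linarith [h1.1, h1.2, h2.1, h2.2]

/-! ### Nonlocal velocity fields -/

/-- Velocity fields depending on a measure that are bounded by `C` and depend on the distribution
function in a Lipschitz way, with constant `c`. -/
structure IsNonlocalField (V : Measure ℝ → ℝ → ℝ) (c C : ℝ) : Prop where
  nonneg : 0 ≤ c
  bound : ∀ (μ : Measure ℝ) [IsProbabilityMeasure μ] (x : ℝ), |V μ x| ≤ C
  lip : ∀ (μ ν : Measure ℝ) [IsProbabilityMeasure μ] [IsProbabilityMeasure ν], μ ≪ volume →
    ν ≪ volume → ∀ x x' D : ℝ, (∀ s, |μ.real (Iic (s + x)) - ν.real (Iic (s + x'))| ≤ D) →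
    |V μ x - V ν x'| ≤ c * D

/-- Translating each measure by its own evaluation point reduces everything to integrals of the same
`w`. Allowing two points `x`, `x'` lets one estimate cover both the space and the measure
dependence. -/
lemma isNonlocalField_velocity {v w : ℝ → ℝ} {L : ℝ≥0} {α β C : ℝ}
    (hv : LipschitzOnWith L v (Ici 0)) (hvb : ∀ s ∈ Ici (0 : ℝ), |v s| ≤ C)
    (hw : BoundedVariationOn w univ) (h0 : ∀ x, 0 ≤ w x) (hz : ∀ x, x ∉ Icc α β → w x = 0) :
    IsNonlocalField (velocity v w) (L * (eVariationOn w univ).toReal) C where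
  nonneg := by positivity
  bound μ _ x := hvb _ (mem_Ici.2 (integral_nonneg fun y => h0 _))
  lip μ ν _ _ hμ hν x x' D hD := by
    have hmap : ∀ (κ : Measure ℝ) (z : ℝ), ∫ y, w (y - z) ∂κ = ∫ y, w y ∂(κ.map (· - z)) :=
      fun κ z => ((measurableEmbedding_subRight z).integral_map _).symm
    have hac : ∀ (κ : Measure ℝ) (z : ℝ), κ ≪ volume → κ.map (· - z) ≪ volume := fun κ z hκ => by
      have := hκ.map (measurable_id.sub_const z)
      simpa [(measurePreserving_sub_right volume z).map_eq] using! this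
    have hprob : ∀ (κ : Measure ℝ) (z : ℝ), IsProbabilityMeasure κ →
      IsProbabilityMeasure (κ.map (· - z)) := fun κ z _ =>
        Measure.isProbabilityMeasure_map (by fun_prop)
    have := hprob μ x inferInstance
    have := hprob ν x' inferInstance
    have hIic : ∀ (κ : Measure ℝ) (z s : ℝ), (κ.map (· - z)).real (Iic s) = κ.real (Iic (s + z)) :=
      fun κ z s => by
        rw [map_measureReal_apply (by fun_prop) measurableSet_Iic]
        congr 1; ext y; simp
    have h1 := hv.dist_le_mul (∫ y, w (y - x) ∂μ) (mem_Ici.2 (integral_nonneg fun y => h0 _))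
      (∫ y, w (y - x') ∂ν) (mem_Ici.2 (integral_nonneg fun y => h0 _))
    rw [Real.dist_eq, Real.dist_eq] at h1
    refine h1.trans ?_
    rw [mul_assoc]
    gcongr
    rw [hmap, hmap]
    refine abs_integral_sub_le_of_boundedVariation (hac μ x hμ) (hac ν x' hν) (fun s => ?_) hw hz
    rw [hIic, hIic]
    exact hD s

/-- The case `μ = ν`: a density at most `M` makes the distribution function `M`-Lipschitz. -/
lemma IsNonlocalField.abs_sub_le {V : Measure ℝ → ℝ → ℝ} {c C : ℝ} (hV : IsNonlocalField V c C)
    {μ : Measure ℝ} [IsProbabilityMeasure μ] {M : ℝ} (hM : DensityLE M μ) (x y : ℝ) :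
    |V μ x - V μ y| ≤ c * (M * |x - y|) := by
  refine hV.lip μ μ hM.absolutelyContinuous hM.absolutelyContinuous x y _ fun s => ?_
  wlog hxy : x ≤ y generalizing x y
  · rw [abs_sub_comm, abs_sub_comm x]; exact this y x (le_of_not_ge hxy)
  have h1 := hM.real_Iic_le hM.pos.le (add_le_add_right hxy s)
  have h2 : μ.real (Iic (s + x)) ≤ μ.real (Iic (s + y)) :=
    measureReal_mono (Iic_subset_Iic.2 (by linarith))
  rw [abs_sub_comm, abs_sub_comm x, abs_of_nonneg (by linarith), abs_of_nonneg (by linarith)]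
  linarith

/-- If two maps are uniformly close, so are the distribution functions of the images. -/
lemma abs_real_map_sub_le {Ω : Type*} [MeasurableSpace Ω] {P : Measure Ω}
    [IsProbabilityMeasure P] {f g : Ω → ℝ} (hf : Measurable f) (hg : Measurable g) {M d : ℝ}
    (hd : 0 ≤ d) (hfM : DensityLE M (P.map f)) (hfg : ∀ᵐ x ∂P, |f x - g x| ≤ d) (s : ℝ) :
    |(P.map f).real (Iic s) - (P.map g).real (Iic s)| ≤ M * d := by
  have := Measure.isProbabilityMeasure_map (μ := P) hf.aemeasurable
  have h1 : (P.map g).real (Iic s) ≤ (P.map f).real (Iic (s + d)) := by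
    rw [map_measureReal_apply hg measurableSet_Iic, map_measureReal_apply hf measurableSet_Iic]
    refine ENNReal.toReal_mono (measure_ne_top _ _) (measure_mono_ae ?_)
    filter_upwards [hfg] with x hx (hxs : g x ≤ s)
    have := abs_le.1 hx
    change f x ≤ s + d
    linarith
  have h2 : (P.map f).real (Iic (s - d)) ≤ (P.map g).real (Iic s) := by
    rw [map_measureReal_apply hg measurableSet_Iic, map_measureReal_apply hf measurableSet_Iic]
    refine ENNReal.toReal_mono (measure_ne_top _ _) (measure_mono_ae ?_)
    filter_upwards [hfg] with x hx (hxs : f x ≤ s - d)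
    have := abs_le.1 hx
    change g x ≤ s
    linarith
  have h3 := hfM.real_Iic_le hfM.pos.le (show s ≤ s + d by linarith)
  have h4 := hfM.real_Iic_le hfM.pos.le (show s - d ≤ s by linarith)
  rw [abs_le]
  constructor <;> linarith

lemma IsNonlocalField.abs_map_sub_le {V : Measure ℝ → ℝ → ℝ} {c C : ℝ}
    (hV : IsNonlocalField V c C) {μ : Measure ℝ} [IsProbabilityMeasure μ] {f g : ℝ → ℝ}
    (hf : Measurable f) (hg : Measurable g) {M d : ℝ} (hfM : DensityLE M (μ.map f))
    (hgM : DensityLE M (μ.map g)) (hfg : ∀ x, |f x - g x| ≤ d) (x : ℝ) :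
    |V (μ.map f) x - V (μ.map g) x| ≤ c * (M * d) := by
  have := Measure.isProbabilityMeasure_map (μ := μ) hf.aemeasurable
  have := Measure.isProbabilityMeasure_map (μ := μ) hg.aemeasurable
  exact hV.lip _ _ hfM.absolutelyContinuous hgM.absolutelyContinuous x x _ fun s =>
    abs_real_map_sub_le hf hg ((abs_nonneg _).trans (hfg 0)) hfM (ae_of_all _ hfg) (s + x)

/-! ### Increasing bi-Lipschitz maps -/

/-- `f` is increasing, and both `f` and its inverse are `κ`-Lipschitz. -/
def OrdBiLip (κ : ℝ) (f : ℝ → ℝ) : Prop :=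
  0 < κ ∧ ∀ x y, x ≤ y → y - x ≤ κ * (f y - f x) ∧ f y - f x ≤ κ * (y - x)

namespace OrdBiLip

variable {κ κ' : ℝ} {f g : ℝ → ℝ}

lemma pos (h : OrdBiLip κ f) : 0 < κ := h.1

lemma monotone (h : OrdBiLip κ f) : Monotone f := fun x y hxy => by
  have h1 := (h.2 x y hxy).1
  have := nonneg_of_mul_nonneg_right ((sub_nonneg.2 hxy).trans h1) h.pos
  linarith

lemma strictMono (h : OrdBiLip κ f) : StrictMono f := fun x y hxy => by
  have h1 := (h.2 x y hxy.le).1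
  have := pos_of_mul_pos_right ((sub_pos.2 hxy).trans_le h1) h.pos.le
  linarith

lemma measurable (h : OrdBiLip κ f) : Measurable f := h.monotone.measurable

lemma abs_sub_le (h : OrdBiLip κ f) (x y : ℝ) : |f x - f y| ≤ κ * |x - y| := by
  wlog hxy : x ≤ y generalizing x y
  · rw [abs_sub_comm, abs_sub_comm x]; exact this y x (le_of_not_ge hxy)
  rw [abs_sub_comm, abs_sub_comm x, abs_of_nonneg (sub_nonneg.2 hxy),
    abs_of_nonneg (sub_nonneg.2 (h.monotone hxy))]
  exact (h.2 x y hxy).2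

lemma le_abs_sub (h : OrdBiLip κ f) (x y : ℝ) : |x - y| ≤ κ * |f x - f y| := by
  wlog hxy : x ≤ y generalizing x y
  · rw [abs_sub_comm, abs_sub_comm (f x)]; exact this y x (le_of_not_ge hxy)
  rw [abs_sub_comm, abs_sub_comm (f x), abs_of_nonneg (sub_nonneg.2 hxy),
    abs_of_nonneg (sub_nonneg.2 (h.monotone hxy))]
  exact (h.2 x y hxy).1

lemma continuous (h : OrdBiLip κ f) : Continuous f :=
  (LipschitzWith.of_dist_le_mul (K := ⟨κ, h.pos.le⟩) fun x y => by
    rw [Real.dist_eq, Real.dist_eq]; exact h.abs_sub_le x y).continuous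

lemma antilipschitzWith (h : OrdBiLip κ f) : AntilipschitzWith ⟨κ, h.pos.le⟩ f :=
  AntilipschitzWith.of_le_mul_dist fun x y => by
    rw [Real.dist_eq, Real.dist_eq]; exact h.le_abs_sub x y

lemma densityLE_map (h : OrdBiLip κ f) {M : ℝ} {μ : Measure ℝ} (hM : DensityLE M μ) :
    DensityLE (M * κ) (μ.map f) :=
  hM.map_of_antilipschitz h.measurable h.antilipschitzWith

lemma mono (h : OrdBiLip κ f) (hκ : κ ≤ κ') : OrdBiLip κ' f :=
  ⟨h.pos.trans_le hκ, fun x y hxy =>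
    ⟨(h.2 x y hxy).1.trans (mul_le_mul_of_nonneg_right hκ (sub_nonneg.2 (h.monotone hxy))),
    (h.2 x y hxy).2.trans (mul_le_mul_of_nonneg_right hκ (sub_nonneg.2 hxy))⟩⟩

lemma comp (hg : OrdBiLip κ' g) (hf : OrdBiLip κ f) : OrdBiLip (κ * κ') (g ∘ f) :=
  ⟨mul_pos hf.pos hg.pos, fun x y hxy => by
    have h1 := hf.2 x y hxy
    have h2 := hg.2 _ _ (hf.monotone hxy)
    simp only [Function.comp_apply]
    constructor
    · calc y - x ≤ κ * (f y - f x) := h1.1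
        _ ≤ κ * (κ' * (g (f y) - g (f x))) := by gcongr; exacts [hf.pos.le, h2.1]
        _ = _ := by ring
    · calc g (f y) - g (f x) ≤ κ' * (f y - f x) := h2.2
        _ ≤ κ' * (κ * (y - x)) := by gcongr; exacts [hg.pos.le, h1.2]
        _ = _ := by ring⟩

lemma id : OrdBiLip 1 id := ⟨one_pos, fun x y _ => by simp⟩

end OrdBiLip

/-! ### Flows of bounded Lipschitz fields -/

lemma hasDerivWithinAt_Ici_of_Icc {f : ℝ → ℝ} {f' a b t : ℝ} (ht : t ∈ Ico a b)
    (h : HasDerivWithinAt f f' (Icc a b) t) : HasDerivWithinAt f f' (Ici t) t :=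
  h.mono_of_mem_nhdsWithin (Icc_mem_nhdsGE_of_mem ht)

lemma exists_isFlow {U : ℝ → ℝ} {K C h : ℝ} (hK : ∀ x y, |U x - U y| ≤ K * |x - y|)
    (hC : ∀ x, |U x| ≤ C) (hh : 0 ≤ h) : ∃ Φ, IsFlow U h Φ := by
  have hC0 : 0 ≤ C := (abs_nonneg _).trans (hC 0)
  have hK0 : 0 ≤ K := by simpa using (abs_nonneg _).trans (hK 1 0)
  have key : ∀ x : ℝ, ∃ α : ℝ → ℝ, α 0 = x ∧
      ∀ t ∈ Icc 0 h, HasDerivWithinAt α (U (α t)) (Icc 0 h) t := fun x => by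
    have hPL : IsPicardLindelof (fun _ y => U y) (⟨0, left_mem_Icc.2 hh⟩ : Icc (0 : ℝ) h) x
        -- The ball radius `C * h` is the farthest a trajectory can travel, so no smallness of `h`
        -- is needed.
        (⟨C * h, mul_nonneg hC0 hh⟩ : ℝ≥0) 0 ⟨C, hC0⟩ ⟨K, hK0⟩ :=
      { lipschitzOnWith := fun t _ => (LipschitzWith.of_dist_le_mul fun x y => by
          rw [Real.dist_eq, Real.dist_eq]; exact hK x y).lipschitzOnWith
        continuousOn := fun _ _ => continuousOn_const
        norm_le := fun _ _ y _ => hC y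
        mul_max_le := by simp [hh]; rfl }
    exact hPL.exists_eq_forall_mem_Icc_hasDerivWithinAt₀
  choose α hα using key
  exact ⟨fun t x => α x t, fun x => hα x⟩

lemma IsFlow.continuousOn {U : ℝ → ℝ} {h : ℝ} {Φ : ℝ → ℝ → ℝ} (hΦ : IsFlow U h Φ) (x : ℝ) :
    ContinuousOn (fun t => Φ t x) (Icc 0 h) := fun t ht => ((hΦ x).2 t ht).continuousWithinAt

lemma IsFlow.abs_sub_le {U : ℝ → ℝ} {C h : ℝ} (hC : ∀ x, |U x| ≤ C) {Φ : ℝ → ℝ → ℝ}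
    (hΦ : IsFlow U h Φ) (x : ℝ) {s t : ℝ} (hs : s ∈ Icc 0 h) (ht : t ∈ Icc 0 h) :
    |Φ t x - Φ s x| ≤ C * |t - s| :=
  (convex_Icc 0 h).norm_image_sub_le_of_norm_hasDerivWithin_le (hΦ x).2
    (fun _ _ => hC _) hs ht

/-- The gap between two trajectories is kept between the barriers `(y - x) * exp (∓K' * t)`. Taking
`K' > K` makes the derivative inequality strict at a contact point, as the comparison principle
requires; then `K'` tends to `K`. -/
lemma IsFlow.ordBiLip {U : ℝ → ℝ} {K h : ℝ} (hK : ∀ x y, |U x - U y| ≤ K * |x - y|)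
    {Φ : ℝ → ℝ → ℝ} (hΦ : IsFlow U h Φ) {t : ℝ} (ht : t ∈ Icc 0 h) :
    OrdBiLip (Real.exp (K * t)) (Φ t) := by
  refine ⟨Real.exp_pos _, fun x y hxy => ?_⟩
  rcases eq_or_lt_of_le hxy with rfl | hlt
  · simp
  have hpos : 0 < y - x := sub_pos.2 hlt
  have hu : ∀ s ∈ Ico 0 h, HasDerivWithinAt (fun s => Φ s y - Φ s x) (U (Φ s y) - U (Φ s x))
      (Ici s) s := fun s hs => hasDerivWithinAt_Ici_of_Icc hs
    (((hΦ y).2 s (Ico_subset_Icc_self hs)).sub ((hΦ x).2 s (Ico_subset_Icc_self hs)))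
  have huc : ContinuousOn (fun s => Φ s y - Φ s x) (Icc 0 h) :=
    (hΦ.continuousOn y).sub (hΦ.continuousOn x)
  have hexp : ∀ a s : ℝ, HasDerivAt (fun s => (y - x) * Real.exp (a * s))
      (a * ((y - x) * Real.exp (a * s))) s := fun a s => by
    have := (((hasDerivAt_id s).const_mul a).exp).const_mul (y - x)
    refine this.congr_deriv ?_
    simp; ring
  have hlow : ∀ K' > K, (y - x) * Real.exp (-K' * t) ≤ Φ t y - Φ t x := fun K' hK' => by
    refine image_le_of_deriv_right_lt_deriv_boundary'
      (f := fun s => (y - x) * Real.exp (-K' * s)) (B := fun s => Φ s y - Φ s x)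
      (fun s _ => (hexp (-K') s).continuousAt.continuousWithinAt)
      (fun s _ => (hexp (-K') s).hasDerivWithinAt) ?_ huc hu (fun s hs hs' => ?_) ht
    · simp [(hΦ x).1, (hΦ y).1]
    · have h1 := (abs_le.1 (hK (Φ s y) (Φ s x))).1
      rw [← hs'] at h1
      have h2 : 0 < (y - x) * Real.exp (-K' * s) := by positivity
      rw [abs_of_pos h2] at h1
      nlinarith
  have hup : ∀ K' > K, Φ t y - Φ t x ≤ (y - x) * Real.exp (K' * t) := fun K' hK' => by
    refine image_le_of_deriv_right_lt_deriv_boundary (f := fun s => Φ s y - Φ s x)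
      (B := fun s => (y - x) * Real.exp (K' * s)) huc hu ?_ (hexp K') (fun s hs hs' => ?_) ht
    · simp [(hΦ x).1, (hΦ y).1]
    · have h1 := (abs_le.1 (hK (Φ s y) (Φ s x))).2
      rw [hs'] at h1
      have h2 : 0 < (y - x) * Real.exp (K' * s) := by positivity
      rw [abs_of_pos h2] at h1
      nlinarith
  have hlow' : (y - x) * Real.exp (-K * t) ≤ Φ t y - Φ t x := by
    refine le_of_tendsto (f := fun K' => (y - x) * Real.exp (-K' * t)) (x := 𝓝[>] K)
      (Tendsto.mono_left ?_ nhdsWithin_le_nhds) (eventually_mem_nhdsWithin.mono hlow)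
    exact Continuous.tendsto (by fun_prop) K
  have hup' : Φ t y - Φ t x ≤ (y - x) * Real.exp (K * t) := by
    refine ge_of_tendsto (f := fun K' => (y - x) * Real.exp (K' * t)) (x := 𝓝[>] K)
      (Tendsto.mono_left ?_ nhdsWithin_le_nhds) (eventually_mem_nhdsWithin.mono hup)
    exact Continuous.tendsto (by fun_prop) K
  refine ⟨?_, by linarith⟩
  calc y - x = Real.exp (K * t) * ((y - x) * Real.exp (-K * t)) := by
        rw [mul_left_comm, ← Real.exp_add]; simp
    _ ≤ _ := by gcongr

/-! ### Euler scheme in Lagrangian coordinates -/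

open Classical in
/-- A flow of `U` on `[0,h]`, if there is one. -/
noncomputable def someFlow (U : ℝ → ℝ) (h : ℝ) : ℝ → ℝ → ℝ :=
  if H : ∃ Φ, IsFlow U h Φ then H.choose else fun _ x => x

lemma isFlow_someFlow {U : ℝ → ℝ} {h : ℝ} (H : ∃ Φ, IsFlow U h Φ) :
    IsFlow U h (someFlow U h) := by
  rw [someFlow, dif_pos H]
  exact H.choose_spec

/-- The fallback value is the constant identity, so this needs no existence of a flow. -/
lemma someFlow_zero (U : ℝ → ℝ) (h x : ℝ) : someFlow U h 0 x = x := by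
  by_cases H : ∃ Φ, IsFlow U h Φ
  · exact (isFlow_someFlow H x).1
  · rw [someFlow, dif_neg H]

/-- Positions after `k` steps of length `h` of the Euler scheme. -/
noncomputable def eulerStep (V : Measure ℝ → ℝ → ℝ) (ρ₀ : Measure ℝ) (h : ℝ) : ℕ → ℝ → ℝ
  | 0 => id
  | k + 1 => someFlow (V (ρ₀.map (eulerStep V ρ₀ h k))) h h ∘ eulerStep V ρ₀ h k

/-- Positions at time `t` in the Euler scheme with steps of length `h`. -/
noncomputable def eulerMap (V : Measure ℝ → ℝ → ℝ) (ρ₀ : Measure ℝ) (h t : ℝ) : ℝ → ℝ :=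
  someFlow (V (ρ₀.map (eulerStep V ρ₀ h ⌊t / h⌋₊))) h (t - ⌊t / h⌋₊ * h) ∘
    eulerStep V ρ₀ h ⌊t / h⌋₊

lemma eulerMap_add (V : Measure ℝ → ℝ → ℝ) (ρ₀ : Measure ℝ) {h t : ℝ} (hh : 0 < h) (k : ℕ)
    (ht : t ∈ Icc 0 h) :
    eulerMap V ρ₀ h (k * h + t) =
      someFlow (V (ρ₀.map (eulerStep V ρ₀ h k))) h t ∘ eulerStep V ρ₀ h k := by
  -- At the right endpoint the floor jumps to `k + 1` and no time remains; the flow at time `0` is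
  -- the identity, so the two adjacent formulas agree.
  rcases eq_or_lt_of_le ht.2 with rfl | hlt
  · have : ⌊(k * t + t) / t⌋₊ = k + 1 := by
      rw [← add_one_mul, mul_div_cancel_right₀ _ hh.ne']
      exact_mod_cast Nat.floor_natCast (R := ℝ) (k + 1)
    simp only [eulerMap, this]
    ext x
    simp only [Function.comp_apply, Nat.cast_add, Nat.cast_one, add_one_mul, sub_self,
      someFlow_zero]
    rfl
  · have : ⌊(k * h + t) / h⌋₊ = k := by
      rw [Nat.floor_eq_iff (div_nonneg (add_nonneg (by positivity) ht.1) hh.le),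
        le_div_iff₀ hh, div_lt_iff₀ hh]
      constructor <;> linarith [ht.1]
    simp only [eulerMap, this, add_sub_cancel_left]

lemma eulerMap_natCast_mul (V : Measure ℝ → ℝ → ℝ) (ρ₀ : Measure ℝ) {h : ℝ} (hh : 0 < h)
    (k : ℕ) : eulerMap V ρ₀ h (k * h) = eulerStep V ρ₀ h k := by
  have := eulerMap_add V ρ₀ hh k (left_mem_Icc.2 hh.le)
  rw [add_zero] at this
  rw [this]
  ext x
  simp [someFlow_zero]

lemma exists_eq_natCast_mul_add {h t : ℝ} (hh : 0 < h) (ht : 0 ≤ t) :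
    ∃ (k : ℕ) (s : ℝ), s ∈ Ico 0 h ∧ t = k * h + s := by
  refine ⟨⌊t / h⌋₊, t - ⌊t / h⌋₊ * h, ⟨?_, ?_⟩, by ring⟩
  · have := Nat.floor_le (div_nonneg ht hh.le)
    rw [le_div_iff₀ hh] at this
    linarith
  · have := Nat.lt_floor_add_one (t / h)
    rw [div_lt_iff₀ hh] at this
    linarith

/-- `a / (1 - c * a * s)` solves `M' = c * M ^ 2`, and a step with frozen rate `c * M` stays below
this solution, by `1 - u ≤ exp (-u)`. -/
lemma inv_mul_exp_le {c a s t : ℝ} (hc : 0 ≤ c) (ha : 0 ≤ a) (ht : 0 ≤ t)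
    (hst : c * a * (s + t) < 1) :
    (1 - c * a * s)⁻¹ * Real.exp (c * (a * (1 - c * a * s)⁻¹) * t) ≤
      (1 - c * a * (s + t))⁻¹ := by
  have h1 : 0 < 1 - c * a * (s + t) := by linarith
  have h2 : 0 < 1 - c * a * s := by
    have : 0 ≤ c * a * t := by positivity
    linarith
  set u := c * (a * (1 - c * a * s)⁻¹) * t with hu
  have h3 : (1 - c * a * s) * (1 - u) = 1 - c * a * (s + t) := by
    rw [hu]; field_simp; ring
  have h4 : 1 - u ≤ Real.exp (-u) := by linarith [Real.add_one_le_exp (-u)]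
  rw [← h3, mul_inv]
  have h5 : 0 < 1 - u := by
    by_contra! h; nlinarith
  gcongr
  rw [← neg_neg u, Real.exp_neg, neg_neg]
  exact inv_anti₀ h5 h4

section

variable {V : Measure ℝ → ℝ → ℝ} {c C : ℝ} (hV : IsNonlocalField V c C) {ρ₀ : Measure ℝ}
  [IsProbabilityMeasure ρ₀] {a T : ℝ} (ha : DensityLE a ρ₀) (hT : c * a * T < 1)

include hV in
lemma exists_isFlow_map {κ h : ℝ} {f : ℝ → ℝ} (ha : DensityLE a ρ₀) (hf : OrdBiLip κ f)
    (hh : 0 ≤ h) : ∃ Φ, IsFlow (V (ρ₀.map f)) h Φ := by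
  have := Measure.isProbabilityMeasure_map (μ := ρ₀) hf.measurable.aemeasurable
  exact exists_isFlow (K := c * (a * κ)) (fun x y => by
    simpa [mul_assoc] using hV.abs_sub_le (hf.densityLE_map ha) x y) (hV.bound _) hh

include hV in
lemma ordBiLip_flow_comp {κ h t : ℝ} {f : ℝ → ℝ} (ha : DensityLE a ρ₀) (hf : OrdBiLip κ f)
    (ht : t ∈ Icc 0 h) {Φ : ℝ → ℝ → ℝ} (hΦ : IsFlow (V (ρ₀.map f)) h Φ) :
    OrdBiLip (κ * Real.exp (c * (a * κ) * t)) (Φ t ∘ f) := by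
  have := Measure.isProbabilityMeasure_map (μ := ρ₀) hf.measurable.aemeasurable
  exact (hΦ.ordBiLip (K := c * (a * κ)) (fun x y => by
    simpa [mul_assoc] using hV.abs_sub_le (hf.densityLE_map ha) x y) ht).comp hf

include hV ha hT in
lemma ordBiLip_eulerStep {h : ℝ} (hh : 0 < h) (k : ℕ) (hk : k * h ≤ T) :
    OrdBiLip (1 - c * a * (k * h))⁻¹ (eulerStep V ρ₀ h k) := by
  have hca : 0 ≤ c * a := mul_nonneg hV.nonneg ha.pos.le
  induction k with
  | zero => simpa [eulerStep] using OrdBiLip.id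
  | succ k ih =>
    push_cast at hk ⊢
    have ih := ih (by linarith)
    have hflow := isFlow_someFlow (exists_isFlow_map hV ha ih hh.le)
    refine (ordBiLip_flow_comp hV ha ih (right_mem_Icc.2 hh.le) hflow).mono ?_
    rw [add_one_mul]
    refine inv_mul_exp_le hV.nonneg ha.pos.le hh.le (lt_of_le_of_lt ?_ hT)
    gcongr
    linarith

include hV ha hT in
lemma isFlow_eulerStep {h : ℝ} (hh : 0 < h) (k : ℕ) (hk : k * h ≤ T) :
    IsFlow (V (ρ₀.map (eulerStep V ρ₀ h k))) h
      (someFlow (V (ρ₀.map (eulerStep V ρ₀ h k))) h) :=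
  isFlow_someFlow (exists_isFlow_map hV ha (ordBiLip_eulerStep hV ha hT hh k hk) hh.le)

include hV ha hT in
lemma ordBiLip_eulerMap {h t : ℝ} (hh : 0 < h) (ht : t ∈ Icc 0 T) :
    OrdBiLip (1 - c * a * T)⁻¹ (eulerMap V ρ₀ h t) := by
  have hca : 0 ≤ c * a := mul_nonneg hV.nonneg ha.pos.le
  obtain ⟨k, s, hs, rfl⟩ := exists_eq_natCast_mul_add hh ht.1
  have hk : k * h ≤ T := by linarith [ht.2, hs.1]
  rw [eulerMap_add V ρ₀ hh k (Ico_subset_Icc_self hs)]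
  refine (ordBiLip_flow_comp hV ha (ordBiLip_eulerStep hV ha hT hh k hk)
    (Ico_subset_Icc_self hs) (isFlow_eulerStep hV ha hT hh k hk)).mono ?_
  have h1 : c * a * (k * h + s) ≤ c * a * T := by gcongr; exact ht.2
  refine (inv_mul_exp_le hV.nonneg ha.pos.le hs.1 (h1.trans_lt hT)).trans ?_
  exact inv_anti₀ (by linarith) (by linarith)

include hV ha hT in
-- The speed is at most `C` within each time step; `key` glues the steps at the grid points by
-- induction.
lemma abs_eulerMap_sub_le {h s t : ℝ} (hh : 0 < h) (hs : s ∈ Icc 0 T) (ht : t ∈ Icc 0 T)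
    (x : ℝ) : |eulerMap V ρ₀ h t x - eulerMap V ρ₀ h s x| ≤ C * |t - s| := by
  have key : ∀ k : ℕ, k * h ≤ T → ∀ s t, 0 ≤ s → s ≤ t → t ≤ k * h + h →
      |eulerMap V ρ₀ h t x - eulerMap V ρ₀ h s x| ≤ C * (t - s) := by
    have cell : ∀ k : ℕ, k * h ≤ T → ∀ s t, k * h ≤ s → s ≤ t → t ≤ k * h + h →
      |eulerMap V ρ₀ h t x - eulerMap V ρ₀ h s x| ≤ C * (t - s) := fun k hk s t hs hst ht => by
      obtain ⟨s, rfl⟩ : ∃ s', s = k * h + s' := ⟨s - k * h, by ring⟩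
      obtain ⟨t, rfl⟩ : ∃ t', t = k * h + t' := ⟨t - k * h, by ring⟩
      have hs' : s ∈ Icc 0 h := ⟨by linarith, by linarith⟩
      have ht' : t ∈ Icc 0 h := ⟨by linarith, by linarith⟩
      have hm := (ordBiLip_eulerStep hV ha hT hh k hk).measurable
      have := Measure.isProbabilityMeasure_map (μ := ρ₀) hm.aemeasurable
      rw [eulerMap_add V ρ₀ hh k hs', eulerMap_add V ρ₀ hh k ht']
      have := (isFlow_eulerStep hV ha hT hh k hk).abs_sub_le (hV.bound _)
        (eulerStep V ρ₀ h k x) hs' ht'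
      rw [abs_of_nonneg (show 0 ≤ t - s by linarith)] at this
      simpa using this
    intro k
    induction k with
    | zero => intro hk s t hs hst ht; exact cell 0 hk s t (by simpa using hs) hst ht
    | succ k ih =>
      intro hk s t hs hst ht
      have hk' : k * h ≤ T := by push_cast at hk; linarith
      have he : ((k + 1 : ℕ) : ℝ) * h = k * h + h := by push_cast; ring
      rcases le_total t (k * h + h) with h1 | h1
      · exact ih hk' s t hs hst h1
      rcases le_total s (k * h + h) with h2 | h2
      · have h3 := ih hk' s (k * h + h) hs h2 le_rfl
        have h4 := cell (k + 1) hk (k * h + h) t (by rw [he]) h1 ht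
        refine (_root_.abs_sub_le _ (eulerMap V ρ₀ h (k * h + h) x) _).trans ?_
        linarith
      · exact cell (k + 1) hk s t (by rwa [he]) hst ht
  wlog hst : s ≤ t generalizing s t
  · rw [abs_sub_comm, abs_sub_comm t]; exact this ht hs (le_of_not_ge hst)
  obtain ⟨k, r, hr, hk⟩ := exists_eq_natCast_mul_add hh ht.1
  rw [abs_of_nonneg (sub_nonneg.2 hst)]
  exact key k (by linarith [ht.2, hr.1]) s t hs.1 hst (by linarith [hr.2])

include hV ha hT in
-- The velocity can jump at a grid point, so only right derivatives are available; the lagged time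
-- `τ` is the last grid point.
lemma hasDerivWithinAt_eulerMap {h t : ℝ} (hh : 0 < h) (ht : t ∈ Icc 0 T) :
    ∃ τ ∈ Icc 0 T, |t - τ| ≤ h ∧ ∀ x, HasDerivWithinAt (fun t => eulerMap V ρ₀ h t x)
      (V (ρ₀.map (eulerMap V ρ₀ h τ)) (eulerMap V ρ₀ h t x)) (Ici t) t := by
  obtain ⟨k, s, hs, rfl⟩ := exists_eq_natCast_mul_add hh ht.1
  have hk : k * h ≤ T := by linarith [ht.2, hs.1]
  refine ⟨k * h, ⟨by positivity, hk⟩, ?_, fun x => ?_⟩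
  · rw [add_sub_cancel_left, abs_of_nonneg hs.1]; exact hs.2.le
  rw [eulerMap_natCast_mul V ρ₀ hh k, eulerMap_add V ρ₀ hh k (Ico_subset_Icc_self hs)]
  have h1 := hasDerivWithinAt_Ici_of_Icc hs
    ((isFlow_eulerStep hV ha hT hh k hk (eulerStep V ρ₀ h k x)).2 s (Ico_subset_Icc_self hs))
  have h2 : HasDerivWithinAt (fun t => t - k * h) 1 (Ici (k * h + s)) (k * h + s) :=
    (hasDerivWithinAt_id _ _).sub_const _
  have h3 := HasDerivWithinAt.scomp_of_eq (k * h + s) h1 h2 (fun y hy => by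
    simp only [mem_Ici] at *; linarith) (by ring)
  rw [one_smul] at h3
  refine h3.congr_of_eventuallyEq ?_ ?_
  · have : Icc (k * h + s) (k * h + h) ∈ 𝓝[≥] (k * h + s) :=
      Icc_mem_nhdsGE (by linarith [hs.2])
    filter_upwards [this] with y hy
    have := eulerMap_add V ρ₀ hh k (t := y - k * h) ⟨by linarith [hy.1, hs.1], by linarith [hy.2]⟩
    rw [add_sub_cancel] at this
    rw [this]
    rfl
  · rw [eulerMap_add V ρ₀ hh k (Ico_subset_Icc_self hs)]
    simp

end

/-! ### Comparison of approximate Lagrangian solutions -/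

/-- A family of increasing bi-Lipschitz maps moving along the velocity field generated by the image
of `ρ₀` at some time within `ε` of the current one. -/
structure IsApproxFlow (V : Measure ℝ → ℝ → ℝ) (ρ₀ : Measure ℝ) (κ C T ε : ℝ)
    (X : ℝ → ℝ → ℝ) : Prop where
  zero : ∀ x, X 0 x = x
  ordBiLip : ∀ t ∈ Icc 0 T, OrdBiLip κ (X t)
  lip : ∀ s ∈ Icc 0 T, ∀ t ∈ Icc 0 T, ∀ x, |X t x - X s x| ≤ C * |t - s|
  deriv : ∀ t ∈ Ico 0 T, ∃ τ ∈ Icc 0 T, |t - τ| ≤ ε ∧ ∀ x,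
    HasDerivWithinAt (fun t => X t x) (V (ρ₀.map (X τ)) (X t x)) (Ici t) t

/-- A family of increasing bi-Lipschitz maps moving along the velocity field generated by the
image of `ρ₀`. -/
structure IsLagrangianSolution (V : Measure ℝ → ℝ → ℝ) (ρ₀ : Measure ℝ) (κ C T : ℝ)
    (X : ℝ → ℝ → ℝ) : Prop where
  zero : ∀ x, X 0 x = x
  ordBiLip : ∀ t, OrdBiLip κ (X t)
  lip : ∀ s t x, |X t x - X s x| ≤ C * |t - s|
  hasDerivAt : ∀ t ∈ Ioo 0 T, ∀ x, HasDerivAt (fun t => X t x) (V (ρ₀.map (X t)) (X t x)) t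

/-- The map `E ↦ E / 2 + η` contracts to its fixed point `2 * η`. This bootstrap replaces Grönwall's
inequality for suprema, whose regularity in time then need not be studied. -/
lemma le_of_forall_half_add {ι : Type*} {f g : ι → ℝ} (hg : ∀ i, 0 ≤ g i) {E₀ η : ℝ}
    (hE₀ : 0 ≤ E₀) (hη : 0 ≤ η) (h0 : ∀ i, f i ≤ E₀ * g i)
    (hstep : ∀ E, 0 ≤ E → (∀ i, f i ≤ E * g i) → ∀ i, f i ≤ (E / 2 + η) * g i) (i : ι) :
    f i ≤ 2 * η * g i := by
  have key : ∀ k : ℕ, ∀ i, f i ≤ (E₀ * (1 / 2) ^ k + 2 * η) * g i := fun k => by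
    induction k with
    | zero => exact fun i => (h0 i).trans (mul_le_mul_of_nonneg_right (by simp [hη]) (hg i))
    | succ k ih =>
      intro i
      refine (hstep _ (by positivity) ih i).trans (le_of_eq ?_)
      ring
  have hlim : Tendsto (fun k : ℕ => (E₀ * (1 / 2 : ℝ) ^ k + 2 * η) * g i) atTop
      (𝓝 ((E₀ * 0 + 2 * η) * g i)) :=
    (((tendsto_pow_atTop_nhds_zero_of_lt_one (by norm_num) (by norm_num)).const_mul E₀).add_const
      _).mul_const _
  simpa using ge_of_tendsto' hlim fun k => key k i

section

variable {V : Measure ℝ → ℝ → ℝ} {c C : ℝ} {ρ₀ : Measure ℝ} [IsProbabilityMeasure ρ₀]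
  {a T κ : ℝ}

lemma IsNonlocalField.nonneg_bound (hV : IsNonlocalField V c C) : 0 ≤ C :=
  (abs_nonneg _).trans (hV.bound (Measure.dirac 0) 0)

lemma IsNonlocalField.abs_sub_map_le (hV : IsNonlocalField V c C) (ha : DensityLE a ρ₀)
    {f g : ℝ → ℝ} (hf : OrdBiLip κ f) (hg : OrdBiLip κ g) {d : ℝ} (hd : ∀ x, |f x - g x| ≤ d)
    (x y : ℝ) :
    |V (ρ₀.map f) x - V (ρ₀.map g) y| ≤ c * (a * κ) * (|x - y| + d) := by
  have := Measure.isProbabilityMeasure_map (μ := ρ₀) hf.measurable.aemeasurable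
  have h1 := hV.abs_sub_le (hf.densityLE_map ha) x y
  have h2 := hV.abs_map_sub_le hf.measurable hg.measurable (hf.densityLE_map ha)
    (hg.densityLE_map ha) hd y
  refine (_root_.abs_sub_le _ (V (ρ₀.map f) y) _).trans ?_
  linarith

/-- The bootstrap is run in the supremum norm weighted by `exp (-lam * t)`. If `|X - Y|` reaches the
barrier `b = (E / 2 + η) * exp (lam * s)`, the velocities differ by at most `K` times the sum of
`b`, the lag error `C * (ε + ε')` and `E * exp (lam * s)`, hence by at most `3 * K * b`. The extra
`1` in `lam` makes the comparison strict. -/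
lemma IsApproxFlow.abs_sub_le (hV : IsNonlocalField V c C) (ha : DensityLE a ρ₀)
    (hT : 0 ≤ T) {ε ε' : ℝ} (hε : 0 ≤ ε) (hε' : 0 ≤ ε') {X Y : ℝ → ℝ → ℝ}
    (hX : IsApproxFlow V ρ₀ κ C T ε X) (hY : IsApproxFlow V ρ₀ κ C T ε' Y) {t : ℝ}
    (ht : t ∈ Icc 0 T) (x : ℝ) :
    |X t x - Y t x| ≤ C * (ε + ε') * Real.exp ((3 * (c * (a * κ)) + 1) * t) := by
  have hC := hV.nonneg_bound
  have hκ := (hX.ordBiLip 0 (left_mem_Icc.2 hT)).pos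
  set K := c * (a * κ) with hKdef
  have hK : 0 ≤ K := mul_nonneg hV.nonneg (mul_nonneg ha.pos.le hκ.le)
  set lam := 3 * K + 1 with hlam
  have main : ∀ η, 0 < η → C * (ε + ε') ≤ 2 * η →
      |X t x - Y t x| ≤ 2 * η * Real.exp (lam * t) := by
    intro η hη hηε
    refine le_of_forall_half_add (ι := Icc 0 T × ℝ) (f := fun p => |X p.1 p.2 - Y p.1 p.2|)
      -- Crude initial bound: both families start at `x` and move at speed at most `C`.
      (g := fun p => Real.exp (lam * p.1)) (fun _ => (Real.exp_pos _).le) (E₀ := 2 * C * T)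
      (by positivity) hη.le ?_ ?_ (⟨t, ht⟩, x)
    · rintro ⟨⟨t, ht⟩, x⟩
      have h1 := hX.lip 0 (left_mem_Icc.2 hT) t ht x
      have h2 := hY.lip 0 (left_mem_Icc.2 hT) t ht x
      rw [hX.zero, sub_zero, abs_of_nonneg ht.1] at h1
      rw [hY.zero, sub_zero, abs_of_nonneg ht.1] at h2
      have h3 : |X t x - Y t x| ≤ 2 * C * t := by
        rw [abs_le] at *; constructor <;> linarith [h1.1, h1.2, h2.1, h2.2]
      refine h3.trans ?_
      have h4 : 1 ≤ Real.exp (lam * t) := Real.one_le_exp (mul_nonneg (by positivity) ht.1)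
      calc 2 * C * t ≤ 2 * C * T := by gcongr; exact ht.2
        _ ≤ _ := le_mul_of_one_le_right (by positivity) h4
    · rintro E hE hbound ⟨⟨t, ht⟩, x⟩
      have hcont : ∀ {Z : ℝ → ℝ → ℝ} {δ : ℝ}, IsApproxFlow V ρ₀ κ C T δ Z →
          ContinuousOn (fun t => Z t x) (Icc 0 T) := fun hZ =>
        (LipschitzOnWith.of_dist_le_mul (K := ⟨C, hC⟩) fun s hs t ht => by
          rw [Real.dist_eq, Real.dist_eq]; exact hZ.lip t ht s hs x).continuousOn
      have hB : ∀ s, HasDerivAt (fun s => (E / 2 + η) * Real.exp (lam * s))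
          (lam * ((E / 2 + η) * Real.exp (lam * s))) s := fun s => by
        refine ((((hasDerivAt_id s).const_mul lam).exp).const_mul (E / 2 + η)).congr_deriv ?_
        simp; ring
      choose! τ hτ hτε hXd using hX.deriv
      choose! τ' hτ' hτε' hYd using hY.deriv
      refine image_norm_le_of_norm_deriv_right_lt_deriv_boundary ((hcont hX).sub (hcont hY))
        (fun s hs => (hXd s hs x).sub (hYd s hs x)) ?_ hB (fun s hs hs' => ?_) ht
      · simp [hX.zero, hY.zero]; positivity
      · have hsI := Ico_subset_Icc_self hs
        have hd : ∀ y, |X (τ s) y - Y (τ' s) y| ≤ C * (ε + ε') + E * Real.exp (lam * s) := by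
          intro y
          have h1 := (hX.lip _ (hτ s hs) s hsI y).trans
            (mul_le_mul_of_nonneg_left (hτε s hs) hC)
          have h2 := (hY.lip _ (hτ' s hs) s hsI y).trans
            (mul_le_mul_of_nonneg_left (hτε' s hs) hC)
          have h3 := hbound (⟨s, hsI⟩, y)
          simp only at h3
          rw [abs_le] at *
          constructor <;> linarith [h1.1, h1.2, h2.1, h2.2, h3.1, h3.2]
        have h4 := hV.abs_sub_map_le ha (hX.ordBiLip _ (hτ s hs)) (hY.ordBiLip _ (hτ' s hs)) hd
          (X s x) (Y s x)
        rw [Real.norm_eq_abs] at hs' ⊢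
        refine h4.trans_lt ?_
        have hs'' : |X s x - Y s x| = (E / 2 + η) * Real.exp (lam * s) := hs'
        rw [← hKdef, hs'', hlam]
        have h5 : 1 ≤ Real.exp (lam * s) := Real.one_le_exp (mul_nonneg (by positivity) hs.1)
        rw [← hlam]
        have h6 : K * (C * (ε + ε')) ≤ K * (2 * η * Real.exp (lam * s)) := by
          refine mul_le_mul_of_nonneg_left (hηε.trans ?_) hK
          exact le_mul_of_one_le_right (by positivity) h5
        have h7 : 0 < (E / 2 + η) * Real.exp (lam * s) := by positivity
        rw [hlam] at *
        nlinarith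
  -- The limit is from above because `main` needs `η > 0` even when the lag error is zero.
  have h8 : Tendsto (fun η => 2 * η * Real.exp (lam * t)) (𝓝[>] (C * (ε + ε') / 2))
      (𝓝 (2 * (C * (ε + ε') / 2) * Real.exp (lam * t))) :=
    (Continuous.tendsto (by fun_prop) _).mono_left nhdsWithin_le_nhds
  rw [mul_div_cancel₀ _ (two_ne_zero)] at h8
  refine ge_of_tendsto h8 (eventually_mem_nhdsWithin.mono fun η hη => ?_)
  have hη' : C * (ε + ε') / 2 < η := hη
  have : 0 ≤ C * (ε + ε') := by positivity
  exact main η (by linarith) (by linarith)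

/-- The maps are uniformly Cauchy, and the limit inherits the closed conditions. Its equation is
obtained in integral form, and continuity of the limiting velocity in time then upgrades the right
derivatives of the approximations to a two-sided one. -/
lemma exists_isLagrangianSolution (hV : IsNonlocalField V c C) (ha : DensityLE a ρ₀)
    (hT : 0 ≤ T) {ε : ℕ → ℝ} (hε : ∀ n, 0 ≤ ε n) (hε0 : Tendsto ε atTop (𝓝 0))
    {X : ℕ → ℝ → ℝ → ℝ} (hX : ∀ n, IsApproxFlow V ρ₀ κ C T (ε n) (X n)) :
    ∃ Y, IsLagrangianSolution V ρ₀ κ C T Y ∧ ∃ B, ∀ n, ∀ t ∈ Icc 0 T, ∀ x,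
      |X n t x - Y t x| ≤ B * ε n := by
  have hC := hV.nonneg_bound
  have hκ := ((hX 0).ordBiLip 0 (left_mem_Icc.2 hT)).pos
  set K := c * (a * κ) with hKdef
  have hK : 0 ≤ K := mul_nonneg hV.nonneg (mul_nonneg ha.pos.le hκ.le)
  set B := C * Real.exp ((3 * K + 1) * T) with hB
  have hB0 : 0 ≤ B := by positivity
  have hcomp : ∀ n m, ∀ t ∈ Icc 0 T, ∀ x, |X n t x - X m t x| ≤ B * (ε n + ε m) :=
    fun n m t ht x => by
      refine ((hX n).abs_sub_le hV ha hT (hε n) (hε m) (hX m) ht x).trans ?_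
      have : Real.exp ((3 * K + 1) * t) ≤ Real.exp ((3 * K + 1) * T) := by
        gcongr; exact ht.2
      have h0 : 0 ≤ C * (ε n + ε m) := mul_nonneg hC (add_nonneg (hε n) (hε m))
      calc _ ≤ C * (ε n + ε m) * Real.exp ((3 * K + 1) * T) := by gcongr
        _ = _ := by rw [hB]; ring
  -- Clamping time to `[0, T]` extends the limit to all times with the same bounds.
  set p : ℝ → ℝ := fun t => projIcc 0 T hT t with hp
  have hpm : ∀ t, p t ∈ Icc 0 T := fun t => (projIcc 0 T hT t).2
  have hpe : ∀ t ∈ Icc 0 T, p t = t := fun t ht => by simp [hp, projIcc_of_mem hT ht]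
  have hplip : ∀ s t, |p t - p s| ≤ |t - s| := fun s t => abs_projIcc_sub_projIcc hT
  have hlim : ∀ t x, ∃ l, Tendsto (fun n => X n (p t) x) atTop (𝓝 l) := fun t x => by
    refine cauchySeq_tendsto_of_complete (Metric.cauchySeq_iff'.2 fun δ hδ => ?_)
    have h1 : Tendsto (fun n => B * (ε n + ε n)) atTop (𝓝 (B * (0 + 0))) :=
      (hε0.add hε0).const_mul B
    have h2 : Tendsto (fun n => B * ε n) atTop (𝓝 (B * 0)) := hε0.const_mul B
    rw [mul_zero] at h2
    obtain ⟨N, hN⟩ := eventually_atTop.1 (h2.eventually (gt_mem_nhds (half_pos hδ)))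
    refine ⟨N, fun n hn => ?_⟩
    rw [Real.dist_eq]
    refine (hcomp n N _ (hpm t) x).trans_lt ?_
    linarith [hN n hn, hN N le_rfl]
  choose Y hY using hlim
  have hYlip : ∀ s t x, |Y t x - Y s x| ≤ C * |t - s| := fun s t x =>
    le_of_tendsto' ((hY t x).sub (hY s x)).abs fun n =>
      ((hX n).lip _ (hpm s) _ (hpm t) x).trans (mul_le_mul_of_nonneg_left (hplip s t) hC)
  have hYbi : ∀ t, OrdBiLip κ (Y t) := fun t => ⟨hκ, fun x y hxy =>
    ⟨ge_of_tendsto' (((hY t y).sub (hY t x)).const_mul κ) fun n =>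
      (((hX n).ordBiLip _ (hpm t)).2 x y hxy).1,
    le_of_tendsto' ((hY t y).sub (hY t x)) fun n =>
      (((hX n).ordBiLip _ (hpm t)).2 x y hxy).2⟩⟩
  have hXY : ∀ n, ∀ t ∈ Icc 0 T, ∀ x, |X n t x - Y t x| ≤ B * ε n := fun n t ht x => by
    have h1 : Tendsto (fun m => B * (ε n + ε m)) atTop (𝓝 (B * (ε n + 0))) :=
      (hε0.const_add _).const_mul B
    rw [add_zero] at h1
    refine le_of_tendsto_of_tendsto' ((hY t x).const_sub (X n t x)).abs h1 fun m => ?_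
    rw [hpe t ht]
    exact hcomp n m t ht x
  refine ⟨Y, ⟨fun x => ?_, hYbi, hYlip, fun t ht x => ?_⟩, B, hXY⟩
  · refine tendsto_nhds_unique (hY 0 x) ?_
    rw [hpe 0 (left_mem_Icc.2 hT)]
    simp [(hX _).zero]
  set b : ℝ → ℝ := fun s => V (ρ₀.map (Y s)) (Y s x) with hb
  have hbc : Continuous b := by
    refine (LipschitzWith.of_dist_le_mul (K := ⟨2 * K * C, by positivity⟩) fun s t => ?_).continuous
    rw [Real.dist_eq, Real.dist_eq]
    refine (hV.abs_sub_map_le ha (hYbi s) (hYbi t) (hYlip t s) _ _).trans ?_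
    calc _ ≤ K * (C * |s - t| + C * |s - t|) := by gcongr; exact hYlip t s x
      _ = 2 * K * C * |s - t| := by ring
  have hint : ∀ s, HasDerivAt (fun t => x + ∫ s in (0 : ℝ)..t, b s) (b s) s := fun s =>
    (intervalIntegral.integral_hasDerivAt_right (hbc.intervalIntegrable _ _)
      (hbc.stronglyMeasurableAtFilter _ _) hbc.continuousAt).const_add x
  have heq : ∀ t ∈ Icc 0 T, Y t x = x + ∫ s in (0 : ℝ)..t, b s := fun t ht => by
    -- The velocity error has a part `B * ε n` from the position and a part `(B + C) * ε n` from the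
    -- measure, where `C * ε n` is the time lag.
    have hbd : ∀ n, |X n t x - (x + ∫ s in (0 : ℝ)..t, b s)| ≤ K * (2 * B + C) * ε n * t :=
      fun n => by
      choose! τ hτ hτε hXd using (hX n).deriv
      have hXc : ContinuousOn (fun t => X n t x) (Icc 0 T) :=
        (LipschitzOnWith.of_dist_le_mul (K := ⟨C, hC⟩) fun s hs t ht => by
          rw [Real.dist_eq, Real.dist_eq]; exact (hX n).lip t ht s hs x).continuousOn
      have := norm_image_sub_le_of_norm_deriv_right_le_segment (a := 0) (b := T)
        (f := fun t => X n t x - (x + ∫ s in (0 : ℝ)..t, b s)) (C := K * (2 * B + C) * ε n)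
        (hXc.sub fun s _ => (hint s).continuousAt.continuousWithinAt)
        (fun s hs => (hXd s hs x).sub (hint s).hasDerivWithinAt) (fun s hs => ?_) t ht
      · simpa [(hX n).zero] using this
      · have hsI := Ico_subset_Icc_self hs
        have hd : ∀ y, |X n (τ s) y - Y s y| ≤ (B + C) * ε n := fun y => by
          have h1 := (hX n).lip _ (hτ s hs) s hsI y
          have h2 := mul_le_mul_of_nonneg_left (hτε s hs) hC
          have h3 := hXY n s hsI y
          rw [abs_sub_comm] at h1
          refine (_root_.abs_sub_le _ (X n s y) _).trans ?_
          linarith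
        refine (hV.abs_sub_map_le ha ((hX n).ordBiLip _ (hτ s hs)) (hYbi s) hd _ _).trans ?_
        calc _ ≤ K * (B * ε n + (B + C) * ε n) := by gcongr; exact hXY n s hsI x
          _ = _ := by ring
    have h0 : Tendsto (fun n => K * (2 * B + C) * ε n * t) atTop
        (𝓝 (K * (2 * B + C) * 0 * t)) := (hε0.const_mul _).mul_const _
    have h1 := (hY t x)
    rw [hpe t ht] at h1
    have h2 := le_of_tendsto_of_tendsto' (h1.sub_const _).abs h0 hbd
    rw [mul_zero, zero_mul] at h2
    exact sub_eq_zero.1 (abs_nonpos_iff.1 h2)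
  refine (hint t).congr_of_eventuallyEq ?_
  filter_upwards [Icc_mem_nhds ht.1 ht.2] with s hs using heq s hs

lemma isApproxFlow_eulerMap (hV : IsNonlocalField V c C) (ha : DensityLE a ρ₀)
    (hT : c * a * T < 1) {h : ℝ} (hh : 0 < h) :
    IsApproxFlow V ρ₀ (1 - c * a * T)⁻¹ C T h (eulerMap V ρ₀ h) where
  zero x := by
    have := eulerMap_natCast_mul V ρ₀ hh 0
    rw [Nat.cast_zero, zero_mul] at this
    rw [this]; rfl
  ordBiLip t ht := ordBiLip_eulerMap hV ha hT hh ht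
  lip s hs t ht x := abs_eulerMap_sub_le hV ha hT hh hs ht x
  deriv t ht := hasDerivWithinAt_eulerMap hV ha hT hh (Ico_subset_Icc_self ht)

end

/-! ### Push-forward curves -/

/-- The image of `ρ₀` under `x ↦ (f x, g x)` is a plan. -/
lemma Winf_map_le {ρ₀ : Measure ℝ} {f g : ℝ → ℝ} (hf : Measurable f) (hg : Measurable g)
    {d : ℝ} (hd : ∀ x, |f x - g x| ≤ d) :
    Winf (ρ₀.map f) (ρ₀.map g) ≤ ENNReal.ofReal d := by
  have hfg : Measurable fun x => (f x, g x) := hf.prodMk hg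
  refine iInf₂_le_of_le (ρ₀.map fun x => (f x, g x)) ⟨?_, ?_⟩ ?_
  · rw [Measure.map_map measurable_fst hfg]; rfl
  · rw [Measure.map_map measurable_snd hfg]; rfl
  · refine essSup_le_of_ae_le _ ?_
    rw [EventuallyLE, ae_map_iff hfg.aemeasurable (measurableSet_le (by fun_prop) (by fun_prop))]
    exact ae_of_all _ fun x => by
      rw [edist_dist, Real.dist_eq]; exact ENNReal.ofReal_le_ofReal (hd x)

lemma isBddDensity_map {ρ₀ : Measure ℝ} (h : IsBddDensity ρ₀) {κ : ℝ} {f : ℝ → ℝ}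
    (hf : OrdBiLip κ f) : IsBddDensity (ρ₀.map f) := by
  have := h.prob
  have := Measure.isProbabilityMeasure_map (μ := ρ₀) hf.measurable.aemeasurable
  obtain ⟨S, hS, hS0⟩ := h.compact_supp
  have hfS := hS.image hf.continuous
  refine isBddDensity_of_densityLE (hf.densityLE_map h.densityLE) hfS ?_
  rw [Measure.map_apply hf.measurable hfS.measurableSet.compl]
  exact measure_mono_null (fun x hx hxS => hx (mem_image_of_mem f hxS)) hS0

lemma isContCurve_map {ρ₀ : Measure ℝ} (h : IsBddDensity ρ₀) {κ C T : ℝ} {X : ℝ → ℝ → ℝ}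
    (hX : ∀ t ∈ Icc 0 T, OrdBiLip κ (X t))
    (hlip : ∀ s ∈ Icc 0 T, ∀ t ∈ Icc 0 T, ∀ x, |X t x - X s x| ≤ C * |t - s|) :
    IsContCurve T fun t => ρ₀.map (X t) where
  mem t ht := isBddDensity_map h (hX t ht)
  cont s hs := by
    have h1 : Tendsto (fun t => ENNReal.ofReal (C * |s - t|)) (𝓝[Icc 0 T] s) (𝓝 0) := by
      have : Tendsto (fun t => ENNReal.ofReal (C * |s - t|)) (𝓝 s)
          (𝓝 (ENNReal.ofReal (C * |s - s|))) :=
        (ENNReal.continuous_ofReal.comp (by fun_prop)).tendsto s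
      simpa using this.mono_left nhdsWithin_le_nhds
    refine tendsto_of_tendsto_of_tendsto_of_le_of_le' tendsto_const_nhds h1
      (Eventually.of_forall fun _ => zero_le) (eventually_mem_nhdsWithin.mono fun t ht => ?_)
    exact Winf_map_le (hX s hs).measurable (hX t ht).measurable fun x => hlip t ht s hs x

lemma isEulerTrajectory_eulerMap {v w : ℝ → ℝ} {c C : ℝ}
    (hV : IsNonlocalField (velocity v w) c C) {ρ₀ : Measure ℝ} [IsProbabilityMeasure ρ₀]
    {a T : ℝ} (ha : DensityLE a ρ₀) (hT : 0 < T) (hcT : c * a * T < 1) (n : ℕ) :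
    IsEulerTrajectory v w ρ₀ T n fun t => ρ₀.map (eulerMap (velocity v w) ρ₀ (T / 2 ^ n) t) := by
  have hh : 0 < T / 2 ^ n := by positivity
  refine ⟨?_, fun k hk => ?_⟩
  · have := (isApproxFlow_eulerMap hV ha hcT hh).zero
    simp only
    rw [show eulerMap (velocity v w) ρ₀ (T / 2 ^ n) 0 = id from funext this, Measure.map_id]
  · have hkT : k * (T / 2 ^ n) ≤ T := by
      have : (k : ℝ) ≤ 2 ^ n := by exact_mod_cast hk.le
      calc k * (T / 2 ^ n) ≤ 2 ^ n * (T / 2 ^ n) := by gcongr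
        _ = T := by field_simp
    have hflow := isFlow_eulerStep hV ha hcT hh k hkT
    have hP := ordBiLip_eulerStep hV ha hcT hh k hkT
    have := Measure.isProbabilityMeasure_map (μ := ρ₀) hP.measurable.aemeasurable
    refine ⟨someFlow (velocity v w (ρ₀.map (eulerStep (velocity v w) ρ₀ (T / 2 ^ n) k)))
      (T / 2 ^ n), ?_, fun t ht => ?_⟩
    · simpa only [eulerMap_natCast_mul _ ρ₀ hh k] using hflow
    · simp only [eulerMap_natCast_mul _ ρ₀ hh k, eulerMap_add _ ρ₀ hh k ht]
      refine (Measure.map_map ?_ hP.measurable).symm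
      exact (hflow.ordBiLip (fun x y =>
        (hV.abs_sub_le (hP.densityLE_map ha) x y).trans_eq (mul_assoc _ _ _).symm) ht).measurable

/-! ### Test functions -/

lemma IsTestFun.hasFDerivAt {T : ℝ} {φ : ℝ × ℝ → ℝ} (hφ : IsTestFun T φ) (p : ℝ × ℝ) :
    HasFDerivAt φ (fderiv ℝ φ p) p :=
  (hφ.smooth.differentiable (by simp) p).hasFDerivAt

lemma IsTestFun.deriv_fst {T : ℝ} {φ : ℝ × ℝ → ℝ} (hφ : IsTestFun T φ) (t x : ℝ) :
    deriv (fun s => φ (s, x)) t = fderiv ℝ φ (t, x) (1, 0) :=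
  (HasFDerivAt.comp_hasDerivAt t (hφ.hasFDerivAt (t, x))
    ((hasDerivAt_id t).prodMk (hasDerivAt_const t x))).deriv

lemma IsTestFun.deriv_snd {T : ℝ} {φ : ℝ × ℝ → ℝ} (hφ : IsTestFun T φ) (t x : ℝ) :
    deriv (fun z => φ (t, z)) x = fderiv ℝ φ (t, x) (0, 1) :=
  (HasFDerivAt.comp_hasDerivAt x (hφ.hasFDerivAt (t, x))
    ((hasDerivAt_const x t).prodMk (hasDerivAt_id x))).deriv

lemma IsTestFun.eq_zero {T : ℝ} {φ : ℝ × ℝ → ℝ} (hφ : IsTestFun T φ) {t : ℝ}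
    (ht : t ∉ Ioo 0 T) (x : ℝ) : φ (t, x) = 0 :=
  image_eq_zero_of_notMem_tsupport fun h => ht (hφ.supp h).1

lemma IsTestFun.continuous_fderiv {T : ℝ} {φ : ℝ × ℝ → ℝ} (hφ : IsTestFun T φ) (e : ℝ × ℝ) :
    Continuous fun p => fderiv ℝ φ p e :=
  (hφ.smooth.continuous_fderiv (by simp)).clm_apply continuous_const

lemma IsTestFun.exists_bound {T : ℝ} {φ : ℝ × ℝ → ℝ} (hφ : IsTestFun T φ) (e : ℝ × ℝ) :
    ∃ A, ∀ p, |fderiv ℝ φ p e| ≤ A := by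
  have h : HasCompactSupport fun p => fderiv ℝ φ p e :=
    (hφ.compact.fderiv ℝ).comp_left (g := fun L : ℝ × ℝ →L[ℝ] ℝ => L e) (by simp)
  exact h.exists_bound_of_continuous (hφ.continuous_fderiv e)

/-! ### Lagrangian solutions are weak solutions -/

section

variable {V : Measure ℝ → ℝ → ℝ} {c C κ T a : ℝ} {ρ₀ : Measure ℝ} {X : ℝ → ℝ → ℝ}

lemma IsLagrangianSolution.continuous (hC : 0 ≤ C) (hX : IsLagrangianSolution V ρ₀ κ C T X) :
    Continuous fun p : ℝ × ℝ => X p.1 p.2 := by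
  refine continuous_prod_of_continuous_lipschitzWith _ ⟨C, hC⟩ (fun t => (hX.ordBiLip t).continuous)
    fun x => LipschitzWith.of_dist_le_mul fun s t => ?_
  rw [Real.dist_eq, Real.dist_eq]; exact hX.lip t s x

variable [IsProbabilityMeasure ρ₀]

lemma IsLagrangianSolution.continuous_field (hV : IsNonlocalField V c C) (ha : DensityLE a ρ₀)
    (hX : IsLagrangianSolution V ρ₀ κ C T X) :
    Continuous fun p : ℝ × ℝ => V (ρ₀.map (X p.1)) (X p.1 p.2) := by
  refine continuous_iff_continuousAt.2 fun p => ?_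
  rw [ContinuousAt, tendsto_iff_dist_tendsto_zero]
  have h : Tendsto (fun q : ℝ × ℝ => c * (a * κ) * (|X q.1 q.2 - X p.1 p.2| + C * |q.1 - p.1|))
      (𝓝 p) (𝓝 (c * (a * κ) * (|X p.1 p.2 - X p.1 p.2| + C * |p.1 - p.1|))) := by
    have := hX.continuous hV.nonneg_bound
    exact Continuous.tendsto (by fun_prop) p
  simp only [sub_self, abs_zero, mul_zero, add_zero] at h
  refine squeeze_zero (fun _ => dist_nonneg) (fun q => ?_) h
  rw [Real.dist_eq]
  exact hV.abs_sub_map_le ha (hX.ordBiLip _) (hX.ordBiLip _) (hX.lip _ _) _ _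

/-- In Lagrangian coordinates the integrand is the time derivative of `φ (t, X t x)`. By Fubini,
time is integrated first, and `φ` vanishes at both ends. -/
lemma IsLagrangianSolution.integral_eq_zero (hV : IsNonlocalField V c C) (ha : DensityLE a ρ₀)
    (hT : 0 ≤ T) (hX : IsLagrangianSolution V ρ₀ κ C T X) {φ : ℝ × ℝ → ℝ}
    (hφ : IsTestFun T φ) :
    ∫ t in (0 : ℝ)..T, ∫ x, (deriv (fun s => φ (s, x)) t
      + V (ρ₀.map (X t)) x * deriv (fun z => φ (t, z)) x) ∂(ρ₀.map (X t)) = 0 := by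
  have hC := hV.nonneg_bound
  have hXc := hX.continuous hC
  set F : ℝ → ℝ → ℝ := fun t x => fderiv ℝ φ (t, X t x) (1, 0)
    + V (ρ₀.map (X t)) (X t x) * fderiv ℝ φ (t, X t x) (0, 1) with hF
  have hpair : Continuous fun p : ℝ × ℝ => (p.1, X p.1 p.2) := continuous_fst.prodMk hXc
  have hFc : Continuous fun p : ℝ × ℝ => F p.1 p.2 :=
    ((hφ.continuous_fderiv (1, 0)).comp hpair).add
      ((hX.continuous_field hV ha).mul ((hφ.continuous_fderiv (0, 1)).comp hpair))
  have h1 : ∀ t, ∫ x, (deriv (fun s => φ (s, x)) t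
      + V (ρ₀.map (X t)) x * deriv (fun z => φ (t, z)) x) ∂(ρ₀.map (X t)) = ∫ x, F t x ∂ρ₀ := by
    intro t
    have hemb : MeasurableEmbedding (X t) :=
      (hX.ordBiLip t).continuous.measurableEmbedding (hX.ordBiLip t).strictMono.injective
    rw [hemb.integral_map]
    simp only [hφ.deriv_fst, hφ.deriv_snd, hF]
  simp only [h1]
  obtain ⟨A, hA⟩ := hφ.exists_bound (1, 0)
  obtain ⟨B, hB⟩ := hφ.exists_bound (0, 1)
  have hprob : ∀ t, IsProbabilityMeasure (ρ₀.map (X t)) := fun t =>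
    Measure.isProbabilityMeasure_map (hX.ordBiLip t).measurable.aemeasurable
  have hint : Integrable (Function.uncurry F) ((volume.restrict (Ioc 0 T)).prod ρ₀) := by
    refine Integrable.of_bound (C := A + C * B) ?_ (ae_of_all _ fun p => ?_)
    · exact hFc.aestronglyMeasurable
    · have := hprob p.1
      have h2 := hA (p.1, X p.1 p.2)
      have h3 := hB (p.1, X p.1 p.2)
      have h4 := hV.bound (ρ₀.map (X p.1)) (X p.1 p.2)
      simp only [Function.uncurry, hF, Real.norm_eq_abs]
      refine (abs_add_le _ _).trans (add_le_add h2 ?_)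
      rw [abs_mul]
      exact mul_le_mul h4 h3 (abs_nonneg _) hC
  rw [intervalIntegral.integral_of_le hT, integral_integral_swap hint]
  have h5 : ∀ x, ∫ t in Ioc 0 T, F t x = 0 := fun x => by
    rw [← intervalIntegral.integral_of_le hT,
      intervalIntegral.integral_eq_sub_of_hasDerivAt_of_le (f := fun t => φ (t, X t x)) hT]
    · simp [hφ.eq_zero]
    · exact (hφ.smooth.continuous.comp (continuous_id.prodMk
        (hXc.comp (continuous_id.prodMk continuous_const)))).continuousOn
    · intro t ht
      have h6 := HasFDerivAt.comp_hasDerivAt t (hφ.hasFDerivAt (t, X t x))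
        ((hasDerivAt_id t).prodMk (hX.hasDerivAt t ht x))
      refine h6.congr_deriv ?_
      have : ((1 : ℝ), V (ρ₀.map (X t)) (X t x)) =
          (1, 0) + V (ρ₀.map (X t)) (X t x) • ((0 : ℝ), (1 : ℝ)) := by simp
      rw [this, map_add, map_smul, smul_eq_mul]
    · exact (Continuous.comp hFc (continuous_id.prodMk continuous_const)).intervalIntegrable _ _
  simp [h5]

end

lemma IsLagrangianSolution.isWeakSolution {v w : ℝ → ℝ} {c C κ T : ℝ}
    (hV : IsNonlocalField (velocity v w) c C) {ρ₀ : Measure ℝ} (h : IsBddDensity ρ₀)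
    (hT : 0 ≤ T) {X : ℝ → ℝ → ℝ} (hX : IsLagrangianSolution (velocity v w) ρ₀ κ C T X) :
    IsWeakSolution v w ρ₀ T fun t => ρ₀.map (X t) where
  curve := isContCurve_map h (fun t _ => hX.ordBiLip t) fun s _ t _ x => hX.lip s t x
  init := by
    have : X 0 = id := funext hX.zero
    simp [this]
  weak φ hφ := by
    have := h.prob
    exact hX.integral_eq_zero hV h.densityLE hT hφ

/-! ### Continuity with respect to the `∞`-Wasserstein distance -/

/-- The strict inequality yields a plan without attainment of the infimum. -/
lemma exists_isPlan_of_Winf_lt {μ ν : Measure ℝ} {r : ℝ} (h : Winf μ ν < ENNReal.ofReal r) :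
    ∃ π : Measure (ℝ × ℝ), IsPlan π μ ν ∧ ∀ᵐ p ∂π, |p.1 - p.2| ≤ r := by
  obtain ⟨π, hπ⟩ := iInf_lt_iff.1 h
  obtain ⟨hp, hlt⟩ := iInf_lt_iff.1 hπ
  refine ⟨π, hp, ?_⟩
  filter_upwards [ENNReal.ae_le_essSup (μ := π) fun p : ℝ × ℝ => edist p.1 p.2] with p hp
  have h1 := hp.trans_lt hlt
  rw [edist_dist, Real.dist_eq] at h1
  exact ((ENNReal.ofReal_lt_ofReal_iff_of_nonneg (abs_nonneg _)).1 h1).le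

lemma IsPlan.isProbabilityMeasure {π : Measure (ℝ × ℝ)} {μ ν : Measure ℝ}
    [IsProbabilityMeasure μ] (h : IsPlan π μ ν) : IsProbabilityMeasure π := by
  constructor
  have h1 : μ univ = 1 := measure_univ
  rwa [← h.1, Measure.map_apply measurable_fst MeasurableSet.univ] at h1

lemma measure_compl_Icc_eq_zero_of_Winf_lt {μ ν : Measure ℝ} {r R : ℝ}
    (h : Winf μ ν < ENNReal.ofReal r) (hR : μ (Icc (-R) R)ᶜ = 0) :
    ν (Icc (-(R + r)) (R + r))ᶜ = 0 := by
  obtain ⟨π, hπ, hae⟩ := exists_isPlan_of_Winf_lt h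
  have h1 : ∀ᵐ p ∂π, p.1 ∈ Icc (-R) R := by
    have : ∀ᵐ x ∂(π.map Prod.fst), x ∈ Icc (-R) R := by
      rw [hπ.1]; exact measure_eq_zero_iff_ae_notMem.1 hR |>.mono fun x hx => not_not.1 hx
    exact ae_of_ae_map measurable_fst.aemeasurable this
  rw [← hπ.2, Measure.map_apply measurable_snd measurableSet_Icc.compl,
    measure_eq_zero_iff_ae_notMem]
  filter_upwards [h1, hae] with p hp hp'
  rw [abs_le] at hp'
  simp only [mem_preimage, mem_compl_iff, not_not]
  constructor <;> linarith [hp.1, hp.2]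

lemma abs_real_Iic_sub_le_of_Winf_lt {μ ν : Measure ℝ} [IsProbabilityMeasure μ] {M r : ℝ}
    (hr : 0 ≤ r) (hM : DensityLE M μ) (h : Winf μ ν < ENNReal.ofReal r) (s : ℝ) :
    |μ.real (Iic s) - ν.real (Iic s)| ≤ M * r := by
  obtain ⟨π, hπ, hae⟩ := exists_isPlan_of_Winf_lt h
  have := hπ.isProbabilityMeasure
  have h1 := abs_real_map_sub_le measurable_fst measurable_snd hr (by rwa [hπ.1]) hae s
  rwa [hπ.1, hπ.2] at h1

lemma abs_integral_sub_le_of_Winf_lt {μ ν : Measure ℝ} [IsProbabilityMeasure μ] {r δ B : ℝ}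
    (h : Winf μ ν < ENNReal.ofReal r) {f : ℝ → ℝ} (hf : Continuous f) (hB : ∀ x, |f x| ≤ B)
    (hδ : ∀ x y, |x - y| ≤ r → |f x - f y| ≤ δ) :
    |∫ x, f x ∂μ - ∫ x, f x ∂ν| ≤ δ := by
  obtain ⟨π, hπ, hae⟩ := exists_isPlan_of_Winf_lt h
  have := hπ.isProbabilityMeasure
  have hi : ∀ g : ℝ × ℝ → ℝ, Continuous g → Integrable (fun p => f (g p)) π := fun g hg =>
    Integrable.of_bound (hf.comp hg).aestronglyMeasurable B (ae_of_all _ fun p => hB _)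
  rw [← hπ.1, ← hπ.2, integral_map measurable_fst.aemeasurable hf.aestronglyMeasurable,
    integral_map measurable_snd.aemeasurable hf.aestronglyMeasurable,
    ← integral_sub (hi _ continuous_fst) (hi _ continuous_snd)]
  have := norm_integral_le_of_norm_le_const (μ := π) (f := fun p => f p.1 - f p.2) (C := δ)
    (hae.mono fun p hp => hδ _ _ hp)
  simpa using this

section

variable {T : ℝ} {ρ : ℝ → Measure ℝ}

lemma IsContCurve.eventually_Winf_lt (h : IsContCurve T ρ) {s : ℝ} (hs : s ∈ Icc 0 T) {r : ℝ}
    (hr : 0 < r) : ∀ᶠ t in 𝓝[Icc 0 T] s, Winf (ρ s) (ρ t) < ENNReal.ofReal r :=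
  (h.cont s hs).eventually (gt_mem_nhds (ENNReal.ofReal_pos.2 hr))

/-- Near each time the support grows by at most `1`; compactness of `[0, T]` makes the bound
uniform. -/
lemma IsContCurve.exists_support (h : IsContCurve T ρ) :
    ∃ R, ∀ t ∈ Icc 0 T, ρ t (Icc (-R) R)ᶜ = 0 := by
  have hmono : ∀ {μ : Measure ℝ} {R R' : ℝ}, R ≤ R' → μ (Icc (-R) R)ᶜ = 0 →
      μ (Icc (-R') R')ᶜ = 0 := fun hR h =>
    measure_mono_null (compl_subset_compl.2 (Icc_subset_Icc (neg_le_neg hR) hR)) h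
  refine isCompact_Icc.induction_on (p := fun s => ∃ R, ∀ t ∈ s, ρ t (Icc (-R) R)ᶜ = 0)
    ⟨0, by simp⟩ (fun s t hst ⟨R, hR⟩ => ⟨R, fun x hx => hR x (hst hx)⟩) ?_ fun s hs => ?_
  · rintro s t ⟨R, hR⟩ ⟨R', hR'⟩
    refine ⟨max R R', fun x hx => hx.elim (fun hx => ?_) fun hx => ?_⟩
    · exact hmono (le_max_left _ _) (hR x hx)
    · exact hmono (le_max_right _ _) (hR' x hx)
  · obtain ⟨S, hS, hS0⟩ := (h.mem s hs).compact_supp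
    obtain ⟨R, hR⟩ := hS.isBounded.subset_closedBall 0
    rw [Real.closedBall_eq_Icc, zero_sub, zero_add] at hR
    have h0 : ρ s (Icc (-R) R)ᶜ = 0 := measure_mono_null (compl_subset_compl.2 hR) hS0
    exact ⟨_, h.eventually_Winf_lt hs one_pos, R + 1, fun t ht =>
      measure_compl_Icc_eq_zero_of_Winf_lt ht h0⟩

variable {V : Measure ℝ → ℝ → ℝ} {c C : ℝ}

lemma IsBddDensity.continuous_field (hV : IsNonlocalField V c C)
    {μ : Measure ℝ} (h : IsBddDensity μ) : Continuous (V μ) := by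
  have := h.prob
  refine (LipschitzWith.of_dist_le_mul (K := ⟨c * (linfNorm μ).toReal,
    mul_nonneg hV.nonneg ENNReal.toReal_nonneg⟩) fun x y => ?_).continuous
  rw [Real.dist_eq, Real.dist_eq]
  exact (hV.abs_sub_le h.densityLE x y).trans_eq (mul_assoc _ _ _).symm

lemma IsBddDensity.integrable_field_mul (hV : IsNonlocalField V c C)
    {μ : Measure ℝ} (h : IsBddDensity μ) {f : ℝ → ℝ} (hf : Continuous f) {B : ℝ}
    (hB : ∀ x, |f x| ≤ B) : Integrable (fun x => V μ x * f x) μ := by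
  have := h.prob
  refine Integrable.of_bound ((h.continuous_field hV).mul hf).aestronglyMeasurable (C * B)
    (ae_of_all _ fun x => ?_)
  rw [Real.norm_eq_abs, abs_mul]
  exact mul_le_mul (hV.bound _ _) (hB x) (abs_nonneg _) hV.nonneg_bound

/-- Only the density bound at the fixed time `s` enters, so no bound uniform along the curve is
needed. -/
lemma IsContCurve.eventually_abs_field_sub_le (hV : IsNonlocalField V c C) (h : IsContCurve T ρ)
    {s : ℝ} (hs : s ∈ Icc 0 T) {δ : ℝ} (hδ : 0 < δ) :
    ∀ᶠ t in 𝓝[Icc 0 T] s, ∀ x, |V (ρ s) x - V (ρ t) x| ≤ δ := by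
  have hs' := h.mem s hs
  have := hs'.prob
  set M := (linfNorm (ρ s)).toReal
  have hM : DensityLE M (ρ s) := hs'.densityLE
  have hcM : 0 ≤ c * M := mul_nonneg hV.nonneg hM.pos.le
  have hr : 0 < δ / (c * M + 1) := by positivity
  filter_upwards [h.eventually_Winf_lt hs hr, eventually_mem_nhdsWithin] with t ht htT x
  have ht' := h.mem t htT
  have := ht'.prob
  refine (hV.lip _ _ hs'.ac ht'.ac x x _ fun y =>
    abs_real_Iic_sub_le_of_Winf_lt hr.le hM ht _).trans ?_
  rw [← mul_assoc, ← mul_div_assoc, div_le_iff₀ (by positivity)]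
  nlinarith

lemma IsContCurve.continuousOn_integral_mul (hV : IsNonlocalField V c C) (h : IsContCurve T ρ)
    {f : ℝ → ℝ} {K B : ℝ} (hf : ∀ x y, |f x - f y| ≤ K * |x - y|) (hB : ∀ x, |f x| ≤ B) :
    ContinuousOn (fun t => ∫ x, V (ρ t) x * f x ∂(ρ t)) (Icc 0 T) := by
  have hC := hV.nonneg_bound
  have hB0 : 0 ≤ B := (abs_nonneg _).trans (hB 0)
  have hK : 0 ≤ K := by simpa using (abs_nonneg _).trans (hf 1 0)
  have hfc : Continuous f := (LipschitzWith.of_dist_le_mul (K := ⟨K, hK⟩) fun x y => by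
    rw [Real.dist_eq, Real.dist_eq]; exact hf x y).continuous
  have hVc : ∀ t ∈ Icc 0 T, Continuous (V (ρ t)) := fun t ht => (h.mem t ht).continuous_field hV
  intro s hs
  have hs' := h.mem s hs
  have := hs'.prob
  set M := (linfNorm (ρ s)).toReal
  have hM : DensityLE M (ρ s) := hs'.densityLE
  have hcM : 0 ≤ c * M := mul_nonneg hV.nonneg hM.pos.le
  rw [ContinuousWithinAt, Metric.tendsto_nhds]
  intro δ hδ
  set N := c * M * B + C * K with hN
  have hN0 : 0 ≤ N := by positivity
  have hr : 0 < δ / (3 * (N + 1)) := by positivity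
  have hd : 0 < δ / (3 * (B + 1)) := by positivity
  filter_upwards [h.eventually_Winf_lt hs hr, h.eventually_abs_field_sub_le hV hs hd,
    eventually_mem_nhdsWithin] with t ht1 ht2 htT
  have := (h.mem t htT).prob
  have h1 : |∫ x, V (ρ s) x * f x ∂(ρ s) - ∫ x, V (ρ s) x * f x ∂(ρ t)| ≤ δ / 3 := by
    refine abs_integral_sub_le_of_Winf_lt (B := C * B) ht1 ((hVc s hs).mul hfc) (fun x => ?_)
      fun x y hxy => ?_
    · rw [abs_mul]
      exact mul_le_mul (hV.bound _ _) (hB x) (abs_nonneg _) hC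
    · have h2 : V (ρ s) x * f x - V (ρ s) y * f y =
          (V (ρ s) x - V (ρ s) y) * f x + V (ρ s) y * (f x - f y) := by ring
      have h3 : |V (ρ s) x * f x - V (ρ s) y * f y| ≤ N * |x - y| := by
        rw [h2]
        refine (abs_add_le _ _).trans ?_
        rw [abs_mul, abs_mul, hN, add_mul]
        have h4 := mul_le_mul (hV.abs_sub_le hM x y) (hB x) (abs_nonneg _)
          (mul_nonneg hV.nonneg (mul_nonneg hM.pos.le (abs_nonneg _)))
        have h5 := mul_le_mul (hV.bound (ρ s) y) (hf x y) (abs_nonneg _) hC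
        linarith
      refine h3.trans ((mul_le_mul_of_nonneg_left hxy hN0).trans ?_)
      rw [← mul_div_assoc, div_le_div_iff₀ (by positivity) (by positivity)]
      nlinarith
  have hint : ∀ u ∈ Icc 0 T, Integrable (fun x => V (ρ u) x * f x) (ρ t) := fun u hu => by
    have := (h.mem u hu).prob
    refine Integrable.of_bound ((hVc u hu).mul hfc).aestronglyMeasurable (C * B)
      (ae_of_all _ fun x => ?_)
    rw [Real.norm_eq_abs, abs_mul]
    exact mul_le_mul (hV.bound _ _) (hB x) (abs_nonneg _) hC
  have h6 : |∫ x, V (ρ s) x * f x ∂(ρ t) - ∫ x, V (ρ t) x * f x ∂(ρ t)| ≤ δ / 3 := by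
    rw [← integral_sub (hint s hs) (hint t htT)]
    have := norm_integral_le_of_norm_le_const (μ := ρ t)
      (f := fun x => V (ρ s) x * f x - V (ρ t) x * f x) (C := δ / 3) (ae_of_all _ fun x => by
        rw [← sub_mul, Real.norm_eq_abs, abs_mul]
        refine (mul_le_mul (ht2 x) (hB x) (abs_nonneg _) hd.le).trans ?_
        rw [div_mul_eq_mul_div, div_le_div_iff₀ (by positivity) (by positivity)]
        nlinarith)
    simpa using this
  rw [dist_comm, Real.dist_eq]
  refine (_root_.abs_sub_le _ (∫ x, V (ρ s) x * f x ∂(ρ t)) _).trans_lt ?_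
  linarith

lemma IsContCurve.continuousOn_integral (h : IsContCurve T ρ)
    {f : ℝ → ℝ} {K B : ℝ} (hf : ∀ x y, |f x - f y| ≤ K * |x - y|) (hB : ∀ x, |f x| ≤ B) :
    ContinuousOn (fun t => ∫ x, f x ∂(ρ t)) (Icc 0 T) := by
  -- The constant field `1` reduces this to the weighted version.
  have hV : IsNonlocalField (fun _ _ => 1) 0 1 :=
    ⟨le_rfl, by simp, by simp⟩
  simpa using h.continuousOn_integral_mul hV hf hB

end

/-! ### From the weak formulation to derivatives of averages -/

lemma deriv_smoothTransition_comp_eq_zero {s δ τ : ℝ} (hδ : 0 < δ) (hτ : τ ∉ Icc s (s + δ)) :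
    deriv (fun τ => Real.smoothTransition ((τ - s) / δ)) τ = 0 := by
  rw [mem_Icc, not_and_or, not_le, not_le] at hτ
  rcases hτ with h | h
  · refine (EventuallyEq.deriv_eq (f := fun _ => 0) ?_).trans (deriv_const _ _)
    filter_upwards [Iio_mem_nhds h] with x hx
    exact Real.smoothTransition.zero_of_nonpos
      (div_nonpos_of_nonpos_of_nonneg (sub_nonpos.2 (le_of_lt hx)) hδ.le)
  · refine (EventuallyEq.deriv_eq (f := fun _ => 1) ?_).trans (deriv_const _ _)
    filter_upwards [Ioi_mem_nhds h] with x hx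
    refine Real.smoothTransition.one_of_one_le ((one_le_div hδ).2 ?_)
    have : s + δ < x := hx
    linarith

lemma contDiff_smoothTransition_comp (s δ : ℝ) :
    ContDiff ℝ ((⊤ : ℕ∞) : WithTop ℕ∞) fun τ => Real.smoothTransition ((τ - s) / δ) :=
  Real.smoothTransition.contDiff.comp ((contDiff_id.sub contDiff_const).div_const δ)

/-- The derivative of a smooth step is an approximate delta: nonnegative, of mass one, vanishing off
`[s, s + δ]`. -/
lemma abs_integral_deriv_smoothTransition_mul_sub_le {T s δ ε : ℝ} (hs : 0 ≤ s) (hδ : 0 < δ)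
    (hT : s + δ ≤ T) {H : ℝ → ℝ} (hH : Continuous H)
    (hε : ∀ τ ∈ Icc s (s + δ), |H τ - H s| ≤ ε) :
    |(∫ τ in (0 : ℝ)..T, deriv (fun τ => Real.smoothTransition ((τ - s) / δ)) τ * H τ) - H s|
      ≤ ε := by
  set k : ℝ → ℝ := fun τ => Real.smoothTransition ((τ - s) / δ) with hk
  have hkd : ContDiff ℝ ((⊤ : ℕ∞) : WithTop ℕ∞) k := contDiff_smoothTransition_comp s δ
  have hkc : Continuous (deriv k) := hkd.continuous_deriv (by simp)
  have hk0 : ∀ τ, 0 ≤ deriv k τ := fun τ => Monotone.deriv_nonneg fun x y hxy =>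
    Real.smoothTransition.monotone (by gcongr)
  have h1 : ∫ τ in (0 : ℝ)..T, deriv k τ = 1 := by
    rw [intervalIntegral.integral_deriv_eq_sub
      (fun x _ => hkd.differentiable (by simp) x) (hkc.intervalIntegrable _ _)]
    have h2 : k T = 1 := Real.smoothTransition.one_of_one_le ((one_le_div hδ).2 (by linarith))
    have h3 : k 0 = 0 := Real.smoothTransition.zero_of_nonpos
      (div_nonpos_of_nonpos_of_nonneg (by linarith) hδ.le)
    rw [h2, h3, sub_zero]
  have h2 : H s = ∫ τ in (0 : ℝ)..T, deriv k τ * H s := by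
    rw [intervalIntegral.integral_mul_const, h1, one_mul]
  have h3 : ε = ∫ τ in (0 : ℝ)..T, deriv k τ * ε := by
    rw [intervalIntegral.integral_mul_const, h1, one_mul]
  have h4 : IntervalIntegrable (fun τ => deriv k τ * H τ) volume 0 T :=
    (hkc.mul hH).intervalIntegrable _ _
  have h5 : ∀ a, IntervalIntegrable (fun τ => deriv k τ * a) volume 0 T := fun a =>
    (hkc.mul continuous_const).intervalIntegrable _ _
  rw [h2, h3, ← intervalIntegral.integral_sub h4 (h5 _), ← Real.norm_eq_abs]
  refine intervalIntegral.norm_integral_le_of_norm_le (by linarith)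
    (ae_of_all _ fun τ _ => ?_) (h5 _)
  rw [← mul_sub, Real.norm_eq_abs, abs_mul, abs_of_nonneg (hk0 τ)]
  by_cases hτ : τ ∈ Icc s (s + δ)
  · exact mul_le_mul_of_nonneg_left (hε τ hτ) (hk0 τ)
  · rw [deriv_smoothTransition_comp_eq_zero hδ hτ]; simp

/-- Smooth functions with compact support in `(0,T)`. -/
structure IsTestFunTime (T : ℝ) (χ : ℝ → ℝ) : Prop where
  smooth : ContDiff ℝ ((⊤ : ℕ∞) : WithTop ℕ∞) χ
  compact : HasCompactSupport χ
  supp : tsupport χ ⊆ Ioo 0 T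

/-- Du Bois-Reymond's lemma: the difference of smooth steps at `s` and at `t` is an admissible test
function, whose derivative approximates a difference of two deltas. -/
lemma eq_of_forall_integral_deriv_mul_eq_zero {T : ℝ} {H : ℝ → ℝ} (hH : Continuous H)
    (h : ∀ χ, IsTestFunTime T χ → ∫ τ in (0 : ℝ)..T, deriv χ τ * H τ = 0) {s t : ℝ}
    (hs : 0 < s) (hst : s < t) (ht : t < T) : H s = H t := by
  refine eq_of_forall_dist_le fun ε hε => ?_
  obtain ⟨δ₁, hδ₁, h1⟩ := Metric.continuous_iff.1 hH s (ε / 2) (half_pos hε)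
  obtain ⟨δ₂, hδ₂, h2⟩ := Metric.continuous_iff.1 hH t (ε / 2) (half_pos hε)
  set δ := min (min δ₁ δ₂) (T - t) / 2 with hδ
  have hmin : 0 < min (min δ₁ δ₂) (T - t) := lt_min (lt_min hδ₁ hδ₂) (sub_pos.2 ht)
  have hδ0 : 0 < δ := half_pos hmin
  have hδ1 : δ < δ₁ := (half_lt_self hmin).trans_le ((min_le_left _ _).trans (min_le_left _ _))
  have hδ2 : δ < δ₂ := (half_lt_self hmin).trans_le ((min_le_left _ _).trans (min_le_right _ _))
  have hδ3 : δ < T - t := (half_lt_self hmin).trans_le (min_le_right _ _)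
  set k : ℝ → ℝ → ℝ := fun s τ => Real.smoothTransition ((τ - s) / δ) with hk
  have hkd : ∀ s, ContDiff ℝ ((⊤ : ℕ∞) : WithTop ℕ∞) (k s) := fun s =>
    contDiff_smoothTransition_comp s δ
  have hkc : ∀ s, Continuous (deriv (k s)) := fun s => (hkd s).continuous_deriv (by simp)
  have hsub : Function.support (fun τ => k s τ - k t τ) ⊆ Icc s (t + δ) := by
    refine Function.support_subset_iff'.2 fun τ hτ => ?_
    rw [mem_Icc, not_and_or, not_le, not_le] at hτ
    rcases hτ with h | h
    · have h3 : k s τ = 0 := Real.smoothTransition.zero_of_nonpos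
        (div_nonpos_of_nonpos_of_nonneg (by linarith) hδ0.le)
      have h4 : k t τ = 0 := Real.smoothTransition.zero_of_nonpos
        (div_nonpos_of_nonpos_of_nonneg (by linarith) hδ0.le)
      rw [h3, h4, sub_zero]
    · have h3 : k s τ = 1 := Real.smoothTransition.one_of_one_le
        ((one_le_div hδ0).2 (by linarith))
      have h4 : k t τ = 1 := Real.smoothTransition.one_of_one_le
        ((one_le_div hδ0).2 (by linarith))
      rw [h3, h4, sub_self]
  have hts : tsupport (fun τ => k s τ - k t τ) ⊆ Icc s (t + δ) :=
    closure_minimal hsub isClosed_Icc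
  have hχ : IsTestFunTime T fun τ => k s τ - k t τ :=
    ⟨(hkd s).sub (hkd t), HasCompactSupport.of_support_subset_isCompact isCompact_Icc hsub,
      hts.trans fun τ hτ => ⟨hs.trans_le hτ.1, by linarith [hτ.2]⟩⟩
  have h0 := h _ hχ
  have hd : ∀ τ, deriv (fun τ => k s τ - k t τ) τ = deriv (k s) τ - deriv (k t) τ := fun τ =>
    deriv_fun_sub ((hkd s).differentiable (by simp) τ) ((hkd t).differentiable (by simp) τ)
  simp only [hd, sub_mul] at h0
  have hki : ∀ s, IntervalIntegrable (fun τ => deriv (k s) τ * H τ) volume 0 T := fun s =>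
    ((hkc s).mul hH).intervalIntegrable _ _
  rw [intervalIntegral.integral_sub (hki s) (hki t)] at h0
  have h5 := abs_integral_deriv_smoothTransition_mul_sub_le (T := T) hs.le hδ0 (by linarith) hH
    (ε := ε / 2) fun τ hτ => (h1 τ (by
      rw [Real.dist_eq, abs_of_nonneg (by linarith [hτ.1])]; linarith [hτ.2])).le
  have h6 := abs_integral_deriv_smoothTransition_mul_sub_le (T := T) (hs.trans hst).le hδ0
    (by linarith) hH (ε := ε / 2) fun τ hτ => (h2 τ (by
      rw [Real.dist_eq, abs_of_nonneg (by linarith [hτ.1])]; linarith [hτ.2])).le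
  rw [Real.dist_eq]
  rw [abs_le] at *
  constructor <;> linarith [h5.1, h5.2, h6.1, h6.2]

/-- Subtracting from `g` a primitive `J` of `h` leaves a function with zero weak derivative, hence
constant on `(0, T)`. -/
lemma hasDerivAt_of_forall_integral_eq_zero {T : ℝ} {g h : ℝ → ℝ}
    (hg : ContinuousOn g (Icc 0 T)) (hh : ContinuousOn h (Icc 0 T))
    (hw : ∀ χ, IsTestFunTime T χ → ∫ τ in (0 : ℝ)..T, (deriv χ τ * g τ + χ τ * h τ) = 0) {s : ℝ}
    (hs : s ∈ Ioo 0 T) : HasDerivAt g (h s) s := by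
  have hT : 0 ≤ T := (hs.1.trans hs.2).le
  set p : ℝ → ℝ := fun t => projIcc 0 T hT t with hp
  have hpm : ∀ t, p t ∈ Icc 0 T := fun t => (projIcc 0 T hT t).2
  have hpc : Continuous p := continuous_subtype_val.comp continuous_projIcc
  have hpe : ∀ t ∈ Icc 0 T, p t = t := fun t ht => by simp [hp, projIcc_of_mem hT ht]
  have hgc : Continuous (g ∘ p) := hg.comp_continuous hpc hpm
  have hhc : Continuous (h ∘ p) := hh.comp_continuous hpc hpm
  set J : ℝ → ℝ := fun t => ∫ τ in (0 : ℝ)..t, (h ∘ p) τ with hJ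
  have hJd : ∀ t, HasDerivAt J ((h ∘ p) t) t := fun t =>
    intervalIntegral.integral_hasDerivAt_right (hhc.intervalIntegrable _ _)
      (hhc.stronglyMeasurableAtFilter _ _) hhc.continuousAt
  have hJc : Continuous J := continuous_iff_continuousAt.2 fun t => (hJd t).continuousAt
  have hconst : ∀ χ, IsTestFunTime T χ →
      ∫ τ in (0 : ℝ)..T, deriv χ τ * (g (p τ) - J τ) = 0 := fun χ hχ => by
    have hχc : Continuous (deriv χ) := hχ.smooth.continuous_deriv (by simp)
    have h1 : ∫ τ in (0 : ℝ)..T, (deriv χ τ * J τ + χ τ * (h ∘ p) τ) = 0 := by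
      rw [intervalIntegral.integral_deriv_mul_eq_sub (u := χ) (v := J)
        (fun x _ => (hχ.smooth.differentiable (by simp) x).hasDerivAt) (fun x _ => hJd x)
        (hχc.intervalIntegrable _ _) (hhc.intervalIntegrable _ _)]
      have h2 : ∀ t, t ∉ Ioo 0 T → χ t = 0 := fun t ht =>
        image_eq_zero_of_notMem_tsupport fun h => ht (hχ.supp h)
      rw [h2 T (by simp), h2 0 (by simp)]; simp
    have h2 := hw χ hχ
    have h3 : ∫ τ in (0 : ℝ)..T, (deriv χ τ * g τ + χ τ * h τ) =
        ∫ τ in (0 : ℝ)..T, (deriv χ τ * (g ∘ p) τ + χ τ * (h ∘ p) τ) :=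
      intervalIntegral.integral_congr fun τ hτ => by
        rw [uIcc_of_le hT] at hτ
        simp [hpe τ hτ]
    rw [h3] at h2
    have hχ' := hχ.smooth.continuous
    have h4 : ∫ τ in (0 : ℝ)..T, deriv χ τ * (g (p τ) - J τ) =
        (∫ τ in (0 : ℝ)..T, (deriv χ τ * (g ∘ p) τ + χ τ * (h ∘ p) τ)) -
        ∫ τ in (0 : ℝ)..T, (deriv χ τ * J τ + χ τ * (h ∘ p) τ) := by
      rw [← intervalIntegral.integral_sub]
      · refine intervalIntegral.integral_congr fun τ _ => ?_
        simp only [Function.comp_apply]; ring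
      · exact ((hχc.mul hgc).add (hχ'.mul hhc)).intervalIntegrable _ _
      · exact ((hχc.mul hJc).add (hχ'.mul hhc)).intervalIntegrable _ _
    rw [h4, h1, h2, sub_zero]
  have hHc : Continuous fun τ => g (p τ) - J τ := hgc.sub hJc
  have heq : ∀ t ∈ Ioo 0 T, g t = (g (p s) - J s) + J t := fun t ht => by
    have : g (p s) - J s = g (p t) - J t := by
      rcases lt_trichotomy s t with hst | rfl | hst
      · exact eq_of_forall_integral_deriv_mul_eq_zero hHc hconst hs.1 hst ht.2
      · rfl
      · exact (eq_of_forall_integral_deriv_mul_eq_zero hHc hconst ht.1 hst hs.2).symm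
    rw [this, hpe t (Ioo_subset_Icc_self ht)]; ring
  have h5 := (hJd s).const_add (g (p s) - J s)
  rw [Function.comp_apply, hpe s (Ioo_subset_Icc_self hs)] at h5
  refine h5.congr_of_eventuallyEq ?_
  filter_upwards [Ioo_mem_nhds hs.1 hs.2] with t ht using by
    rw [heq t ht, hpe s (Ioo_subset_Icc_self hs)]

/-- A compactly supported smooth function on the line. -/
structure IsTestFunSpace (ψ : ℝ → ℝ) : Prop where
  smooth : ContDiff ℝ ((⊤ : ℕ∞) : WithTop ℕ∞) ψ
  compact : HasCompactSupport ψ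

namespace IsTestFunSpace

variable {ψ : ℝ → ℝ}

lemma deriv (h : IsTestFunSpace ψ) : IsTestFunSpace (deriv ψ) :=
  ⟨(contDiff_infty_iff_deriv.1 h.smooth).2, h.compact.deriv⟩

lemma hasDerivAt (h : IsTestFunSpace ψ) (x : ℝ) : HasDerivAt ψ (_root_.deriv ψ x) x :=
  (h.smooth.differentiable (by simp) x).hasDerivAt

lemma exists_bound (h : IsTestFunSpace ψ) : ∃ B, ∀ x, |ψ x| ≤ B :=
  h.compact.exists_bound_of_continuous h.smooth.continuous

lemma exists_lipschitz (h : IsTestFunSpace ψ) : ∃ K, ∀ x y, |ψ x - ψ y| ≤ K * |x - y| := by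
  obtain ⟨K, hK⟩ := h.deriv.exists_bound
  refine ⟨K, fun x y => ?_⟩
  exact convex_univ.norm_image_sub_le_of_norm_deriv_le
    (fun x _ => h.smooth.differentiable (by simp) x) (fun x _ => hK x) (mem_univ y) (mem_univ x)

lemma comp_sub (h : IsTestFunSpace ψ) (y : ℝ) : IsTestFunSpace fun x => ψ (x - y) :=
  ⟨h.smooth.comp (contDiff_id.sub contDiff_const),
    h.compact.comp_homeomorph (Homeomorph.subRight y)⟩

end IsTestFunSpace

lemma isTestFun_mul {T : ℝ} {χ ψ : ℝ → ℝ} (hχ : IsTestFunTime T χ) (hψ : IsTestFunSpace ψ) :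
    IsTestFun T fun p => χ p.1 * ψ p.2 := by
  have hsub : Function.support (fun p : ℝ × ℝ => χ p.1 * ψ p.2) ⊆ tsupport χ ×ˢ tsupport ψ :=
    fun p hp => by
      rw [Function.mem_support] at hp
      exact ⟨subset_tsupport _ (left_ne_zero_of_mul hp), subset_tsupport _ (right_ne_zero_of_mul hp)⟩
  refine ⟨(hχ.smooth.comp contDiff_fst).mul (hψ.smooth.comp contDiff_snd),
    HasCompactSupport.of_support_subset_isCompact (hχ.compact.isCompact.prod hψ.compact.isCompact)
      hsub, ?_⟩
  refine (closure_minimal hsub ((isClosed_tsupport _).prod (isClosed_tsupport _))).trans ?_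
  exact prod_mono hχ.supp (subset_univ _)

section

variable {v w : ℝ → ℝ} {c C T : ℝ} {ρ₀ : Measure ℝ} {ρ : ℝ → Measure ℝ}

/-- Product test functions `χ(t) * ψ(x)` turn the weak formulation into a weak derivative in time.
Continuity of both sides makes it classical. -/
lemma IsWeakSolution.hasDerivAt_integral (hV : IsNonlocalField (velocity v w) c C)
    (hρ : IsWeakSolution v w ρ₀ T ρ) {ψ : ℝ → ℝ} (hψ : IsTestFunSpace ψ) {s : ℝ}
    (hs : s ∈ Ioo 0 T) :
    HasDerivAt (fun t => ∫ x, ψ x ∂(ρ t)) (∫ x, velocity v w (ρ s) x * deriv ψ x ∂(ρ s)) s := by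
  obtain ⟨B, hB⟩ := hψ.exists_bound
  obtain ⟨K, hK⟩ := hψ.exists_lipschitz
  obtain ⟨B', hB'⟩ := hψ.deriv.exists_bound
  obtain ⟨K', hK'⟩ := hψ.deriv.exists_lipschitz
  refine hasDerivAt_of_forall_integral_eq_zero (hρ.curve.continuousOn_integral hK hB)
    (hρ.curve.continuousOn_integral_mul hV hK' hB') (fun χ hχ => ?_) hs
  refine Eq.trans ?_ (hρ.weak _ (isTestFun_mul hχ hψ))
  refine intervalIntegral.integral_congr fun t ht => ?_
  rw [uIcc_of_le (hs.1.trans hs.2).le] at ht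
  have hb := hρ.curve.mem t ht
  have := hb.prob
  have h1 : ∀ x, deriv (fun s => χ s * ψ x) t = deriv χ t * ψ x := fun x =>
    deriv_mul_const (hχ.smooth.differentiable (by simp) t) _
  have h2 : ∀ x, deriv (fun z => χ t * ψ z) x = χ t * deriv ψ x := fun x =>
    deriv_const_mul _ (hψ.smooth.differentiable (by simp) x)
  simp only [h1, h2]
  have h3 : ∀ x, velocity v w (ρ t) x * (χ t * deriv ψ x) =
    χ t * (velocity v w (ρ t) x * deriv ψ x) := fun x => by ring
  simp only [h3]
  rw [integral_add, integral_const_mul, integral_const_mul]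
  · exact (Integrable.of_bound hψ.smooth.continuous.aestronglyMeasurable B
      (ae_of_all _ hB)).const_mul _
  · exact (hb.integrable_field_mul hV hψ.deriv.smooth.continuous hB').const_mul _

end

/-! ### Averages over moving windows -/

section

variable {v w : ℝ → ℝ} {c C T : ℝ} {ρ₀ : Measure ℝ} {ρ : ℝ → Measure ℝ} {ψ : ℝ → ℝ}

lemma IsContCurve.continuousOn_integral_mul_comp_sub {V : Measure ℝ → ℝ → ℝ}
    (hV : IsNonlocalField V c C) (h : IsContCurve T ρ) (hψ : IsTestFunSpace ψ) :
    ContinuousOn (fun p : ℝ × ℝ => ∫ x, V (ρ p.1) x * ψ (x - p.2) ∂(ρ p.1))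
      (Icc 0 T ×ˢ univ) := by
  have hC := hV.nonneg_bound
  obtain ⟨B, hB⟩ := hψ.exists_bound
  obtain ⟨K, hK⟩ := hψ.exists_lipschitz
  have hK0 : 0 ≤ K := by simpa using (abs_nonneg _).trans (hK 1 0)
  refine continuousOn_prod_of_continuousOn_lipschitzOnWith' _ ⟨C * K, by positivity⟩
    (fun t ht => (LipschitzWith.of_dist_le_mul fun y z => ?_).lipschitzOnWith) fun y _ => ?_
  · have hb := h.mem t ht
    have := hb.prob
    have hi : ∀ y, Integrable (fun x => V (ρ t) x * ψ (x - y)) (ρ t) := fun y =>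
      hb.integrable_field_mul hV (hψ.comp_sub y).smooth.continuous fun x => hB _
    rw [Real.dist_eq, Real.dist_eq]
    simp only
    rw [← integral_sub (hi y) (hi z)]
    have := norm_integral_le_of_norm_le_const (μ := ρ t)
      (f := fun x => V (ρ t) x * ψ (x - y) - V (ρ t) x * ψ (x - z)) (C := C * (K * |y - z|))
      (ae_of_all _ fun x => by
        rw [← mul_sub, Real.norm_eq_abs, abs_mul]
        refine mul_le_mul (hV.bound _ _) ((hK _ _).trans_eq ?_) (abs_nonneg _) hC
        rw [sub_sub_sub_cancel_left, abs_sub_comm])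
    rw [Real.norm_eq_abs, probReal_univ, mul_one, ← mul_assoc] at this
    exact this
  · exact h.continuousOn_integral_mul hV (f := fun x => ψ (x - y)) (K := K)
      (fun x x' => by simpa using hK (x - y) (x' - y)) fun x => hB _

lemma IsContCurve.continuousOn_integral_comp_sub (h : IsContCurve T ρ) (hψ : IsTestFunSpace ψ) :
    ContinuousOn (fun p : ℝ × ℝ => ∫ x, ψ (x - p.2) ∂(ρ p.1)) (Icc 0 T ×ˢ univ) := by
  have hV : IsNonlocalField (fun _ _ => 1) 0 1 := ⟨le_rfl, by simp, by simp⟩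
  simpa using h.continuousOn_integral_mul_comp_sub hV hψ

lemma hasDerivAt_integral_comp_sub {μ : Measure ℝ} [IsProbabilityMeasure μ]
    (hψ : IsTestFunSpace ψ) (y : ℝ) :
    HasDerivAt (fun y => ∫ x, ψ (x - y) ∂μ) (-∫ x, deriv ψ (x - y) ∂μ) y := by
  obtain ⟨B, hB⟩ := hψ.exists_bound
  obtain ⟨B', hB'⟩ := hψ.deriv.exists_bound
  have hc : ∀ {f : ℝ → ℝ} (_ : IsTestFunSpace f) (y : ℝ),
      AEStronglyMeasurable (fun x => f (x - y)) μ := fun hf y =>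
    (hf.comp_sub y).smooth.continuous.aestronglyMeasurable
  rw [← integral_neg]
  refine (hasDerivAt_integral_of_dominated_loc_of_deriv_le (F := fun y x => ψ (x - y))
    (F' := fun y x => -deriv ψ (x - y)) (bound := fun _ => B') univ_mem
    (Eventually.of_forall fun y => hc hψ y)
    (Integrable.of_bound (hc hψ y) B (ae_of_all _ fun x => hB _)) (hc hψ.deriv y).neg
    (ae_of_all _ fun x y _ => ?_) (integrable_const _) (ae_of_all _ fun x y _ => ?_)).2
  · simpa using hB' (x - y)
  · exact ((hψ.hasDerivAt (x - y)).comp y ((hasDerivAt_id y).const_sub x)).congr_deriv (by simp)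

/-- Both partial derivatives of `(t, y) ↦ ∫ ψ (x - y) dρ(t)` are continuous at `(s, z s)`, so this
function is differentiable there and the chain rule applies. -/
lemma IsWeakSolution.hasDerivAt_integral_comp_sub (hV : IsNonlocalField (velocity v w) c C)
    (hρ : IsWeakSolution v w ρ₀ T ρ) (hψ : IsTestFunSpace ψ) {s : ℝ} (hs : s ∈ Ioo 0 T)
    {z : ℝ → ℝ} {z' : ℝ} (hz : HasDerivAt z z' s) :
    HasDerivAt (fun t => ∫ x, ψ (x - z t) ∂(ρ t))
      (∫ x, (velocity v w (ρ s) x - z') * deriv ψ (x - z s) ∂(ρ s)) s := by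
  set A : ℝ → ℝ → ℝ := fun t y => ∫ x, velocity v w (ρ t) x * deriv ψ (x - y) ∂(ρ t) with hA
  set B : ℝ → ℝ → ℝ := fun t y => -∫ x, deriv ψ (x - y) ∂(ρ t) with hB
  have hd : ∀ y, deriv (fun x => ψ (x - y)) = fun x => deriv ψ (x - y) := fun y => by
    ext x; exact deriv_comp_sub_const _ _ _
  have hnhds : (Icc 0 T ×ˢ univ : Set (ℝ × ℝ)) ∈ 𝓝 (s, z s) :=
    prod_mem_nhds (Icc_mem_nhds hs.1 hs.2) univ_mem
  have hIoo : ∀ᶠ p : ℝ × ℝ in 𝓝 (s, z s), p.1 ∈ Ioo 0 T :=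
    continuous_fst.continuousAt.eventually (Ioo_mem_nhds hs.1 hs.2)
  have hAc : ContinuousAt (fun p : ℝ × ℝ => A p.1 p.2) (s, z s) :=
    (hρ.curve.continuousOn_integral_mul_comp_sub hV hψ.deriv).continuousAt hnhds
  have hBc : ContinuousAt (fun p : ℝ × ℝ => B p.1 p.2) (s, z s) :=
    ((hρ.curve.continuousOn_integral_comp_sub hψ.deriv).continuousAt hnhds).neg
  have hstrict := hasStrictFDerivAt_uncurry_coprod (𝕜 := ℝ) (u := (s, z s))
    (f := fun t y => ∫ x, ψ (x - y) ∂(ρ t))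
    (f₁ := fun t y => A t y • (1 : ℝ →L[ℝ] ℝ)) (f₂ := fun t y => B t y • (1 : ℝ →L[ℝ] ℝ))
    (hIoo.mono fun p hp => by
      have h1 := hρ.hasDerivAt_integral hV (hψ.comp_sub p.2) hp
      rw [hd] at h1
      refine h1.hasFDerivAt.congr_fderiv ?_
      ext; simp [Function.HasUncurry.uncurry, hA])
    (hIoo.mono fun p hp => by
      have := (hρ.curve.mem p.1 (Ioo_subset_Icc_self hp)).prob
      refine (NonlocalTransport.hasDerivAt_integral_comp_sub (μ := ρ p.1)
        hψ p.2).hasFDerivAt.congr_fderiv ?_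
      ext; simp [Function.HasUncurry.uncurry, hB])
    (hAc.smul continuousAt_const) (hBc.smul continuousAt_const)
  have h2 := hstrict.hasFDerivAt.comp_hasDerivAt (f := fun t => (t, z t)) s
    ((hasDerivAt_id s).prodMk hz)
  refine h2.congr_deriv ?_
  have hb := hρ.curve.mem s (Ioo_subset_Icc_self hs)
  have := hb.prob
  obtain ⟨B', hB'⟩ := hψ.deriv.exists_bound
  have hc := (hψ.deriv.comp_sub (z s)).smooth.continuous
  simp only [sub_mul]
  rw [integral_sub (hb.integrable_field_mul hV hc fun x => hB' _)
    ((Integrable.of_bound hc.aestronglyMeasurable B' (ae_of_all _ fun x => hB' _)).const_mul z'),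
    integral_const_mul]
  simp [Function.HasUncurry.uncurry, hA, hB]
  ring

/-- A smooth decreasing step, cut off far to the left. -/
lemma exists_step {ε W : ℝ} (hε : 0 < ε) :
    ∃ ψ : ℝ → ℝ, IsTestFunSpace ψ ∧ (∀ u, 0 ≤ ψ u ∧ ψ u ≤ 1) ∧
      (∀ u, -W ≤ u → u ≤ 0 → ψ u = 1) ∧ (∀ u, ε < u → ψ u = 0) ∧
      (∀ u, -W ≤ u → deriv ψ u ≤ 0) ∧ (∀ u, -W ≤ u → u ∉ Icc 0 ε → deriv ψ u = 0) := by
  set k : ℝ → ℝ := fun u => Real.smoothTransition ((u - 0) / ε) with hk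
  have hkd : ContDiff ℝ ((⊤ : ℕ∞) : WithTop ℕ∞) k := contDiff_smoothTransition_comp 0 ε
  set l : ℝ → ℝ := fun u => Real.smoothTransition ((u - (-W - 2)) / 1) with hl
  have hld : ContDiff ℝ ((⊤ : ℕ∞) : WithTop ℕ∞) l := contDiff_smoothTransition_comp _ 1
  have hl1 : ∀ u, -W - 1 ≤ u → l u = 1 := fun u hu =>
    Real.smoothTransition.one_of_one_le (by rw [div_one]; linarith)
  have hk1 : ∀ u, ε ≤ u → k u = 1 := fun u hu =>
    Real.smoothTransition.one_of_one_le (by rw [sub_zero]; exact (one_le_div hε).2 hu)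
  have hk0 : ∀ u, u ≤ 0 → k u = 0 := fun u hu => Real.smoothTransition.zero_of_nonpos
    (div_nonpos_of_nonpos_of_nonneg (by linarith) hε.le)
  have hmono : Monotone k := fun x y hxy => Real.smoothTransition.monotone (by gcongr)
  have hder : ∀ u, -W ≤ u → deriv (fun u => l u * (1 - k u)) u = -deriv k u := fun u hu => by
    have h1 : (fun u => l u * (1 - k u)) =ᶠ[𝓝 u] fun u => 1 - k u := by
      filter_upwards [Ioi_mem_nhds (show -W - 1 < u by linarith)] with x hx
      rw [hl1 x (le_of_lt hx), one_mul]
    rw [h1.deriv_eq, deriv_const_sub]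
  have hsupp : Function.support (fun u => l u * (1 - k u)) ⊆ Icc (-W - 2) ε := by
    refine Function.support_subset_iff'.2 fun u hu => ?_
    rw [mem_Icc, not_and_or, not_le, not_le] at hu
    rcases hu with h | h
    · have : l u = 0 := Real.smoothTransition.zero_of_nonpos (by rw [div_one]; linarith)
      rw [this, zero_mul]
    · rw [hk1 u h.le, sub_self, mul_zero]
  refine ⟨fun u => l u * (1 - k u), ⟨hld.mul (contDiff_const.sub hkd),
    HasCompactSupport.of_support_subset_isCompact isCompact_Icc hsupp⟩, fun u => ?_,
    fun u hu hu' => ?_, fun u hu => ?_, fun u hu => ?_, fun u hu hu' => ?_⟩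
  · have h1 : 0 ≤ l u ∧ l u ≤ 1 :=
      ⟨Real.smoothTransition.nonneg _, Real.smoothTransition.le_one _⟩
    have h2 : 0 ≤ k u ∧ k u ≤ 1 :=
      ⟨Real.smoothTransition.nonneg _, Real.smoothTransition.le_one _⟩
    exact ⟨mul_nonneg h1.1 (by linarith), mul_le_one₀ h1.2 (by linarith) (by linarith)⟩
  · simp only
    rw [hl1 u (by linarith), hk0 u hu']; norm_num
  · simp only
    rw [hk1 u hu.le, sub_self, mul_zero]
  · rw [hder u hu]
    have : 0 ≤ deriv k u := hmono.deriv_nonneg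
    linarith
  · rw [hder u hu, neg_eq_zero]
    exact deriv_smoothTransition_comp_eq_zero hε (by rwa [zero_add])

/-- The condition `R + z ≤ W` puts the left cutoff of `ψ` outside the mass, so `ψ (· - z)` acts as a
smoothed indicator of `(-∞, z]`. -/
lemma integral_comp_sub_mem_of_step {μ : Measure ℝ} [IsProbabilityMeasure μ] {ε W R z : ℝ}
    (hR : μ (Icc (-R) R)ᶜ = 0) (hW : R + z ≤ W) (hψ : IsTestFunSpace ψ)
    (h01 : ∀ u, 0 ≤ ψ u ∧ ψ u ≤ 1) (h1 : ∀ u, -W ≤ u → u ≤ 0 → ψ u = 1)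
    (h0 : ∀ u, ε < u → ψ u = 0) :
    μ.real (Iic z) ≤ ∫ x, ψ (x - z) ∂μ ∧ ∫ x, ψ (x - z) ∂μ ≤ μ.real (Iic (z + ε)) := by
  have hi : Integrable (fun x => ψ (x - z)) μ :=
    Integrable.of_bound (hψ.comp_sub z).smooth.continuous.aestronglyMeasurable 1
      (ae_of_all _ fun x => by
        rw [Real.norm_eq_abs, abs_of_nonneg (h01 _).1]; exact (h01 _).2)
  have hind : ∀ z, ∫ x, (Iic z).indicator (fun _ => (1 : ℝ)) x ∂μ = μ.real (Iic z) := fun z => by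
    rw [integral_indicator measurableSet_Iic]; simp
  have hii : ∀ z, Integrable ((Iic z).indicator fun _ => (1 : ℝ)) μ := fun z =>
    (integrable_const 1).indicator measurableSet_Iic
  constructor
  · rw [← hind]
    refine integral_mono_ae (hii z) hi ?_
    filter_upwards [measure_eq_zero_iff_ae_notMem.1 hR] with x hx
    have hx := (not_not.1 hx).1
    by_cases hxz : x ≤ z
    · rw [indicator_of_mem (mem_Iic.2 hxz), h1 _ (by linarith) (by linarith)]
    · rw [indicator_of_notMem (by simpa using hxz)]; exact (h01 _).1
  · rw [← hind]
    refine integral_mono hi (hii _) fun x => ?_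
    by_cases hxz : x ≤ z + ε
    · rw [indicator_of_mem (mem_Iic.2 hxz)]; exact (h01 _).2
    · rw [h0 (x - z) (by linarith [not_le.1 hxz]), indicator_of_notMem (by simpa using hxz)]

variable {z z' : ℝ → ℝ} {ε t : ℝ}

/-- Continuity on `[0,T]` of averages over moving windows. -/
lemma IsContCurve.continuousOn_integral_comp_sub_curve (h : IsContCurve T ρ)
    (hψ : IsTestFunSpace ψ) (hz : ContinuousOn z (Icc 0 T)) :
    ContinuousOn (fun t => ∫ x, ψ (x - z t) ∂(ρ t)) (Icc 0 T) :=
  (h.continuousOn_integral_comp_sub hψ).comp (continuousOn_id.prodMk hz)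
    fun _ ht => ⟨ht, mem_univ _⟩

lemma exists_upper_bound_of_continuousOn_Icc (hz : ContinuousOn z (Icc 0 T)) :
    ∃ Z, ∀ t ∈ Icc 0 T, z t ≤ Z := by
  obtain ⟨Z, hZ⟩ := (isCompact_Icc.image_of_continuousOn hz).bddAbove
  exact ⟨Z, fun t ht => hZ (mem_image_of_mem z ht)⟩

/-- Mass does not cross from left to right a front that is faster than the velocity field. -/
lemma IsWeakSolution.real_Iic_le_of_le (hV : IsNonlocalField (velocity v w) c C)
    (hρ : IsWeakSolution v w ρ₀ T ρ) (hε : 0 < ε) (hz : ContinuousOn z (Icc 0 T))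
    (hz' : ∀ s ∈ Ioo 0 T, HasDerivAt z (z' s) s)
    (hvel : ∀ s ∈ Ioo 0 T, ∀ x ∈ Icc (z s) (z s + ε), velocity v w (ρ s) x ≤ z' s)
    (ht : t ∈ Icc 0 T) : (ρ 0).real (Iic (z 0)) ≤ (ρ t).real (Iic (z t + ε)) := by
  obtain ⟨R, hR⟩ := hρ.curve.exists_support
  obtain ⟨Z, hZ⟩ := exists_upper_bound_of_continuousOn_Icc hz
  -- `R + Z` keeps the cutoff to the left of all mass at every time; there `ψ'` is nonpositive and
  -- lives on `[0, ε]`, where the front speed is compared with the field.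
  obtain ⟨ψ, hψ, h01, h1, h0, hd, hd0⟩ := exists_step (W := R + Z) hε
  have h0T : (0 : ℝ) ∈ Icc 0 T := left_mem_Icc.2 (ht.1.trans ht.2)
  have hmono : MonotoneOn (fun t => ∫ x, ψ (x - z t) ∂(ρ t)) (Icc 0 T) := by
    refine monotoneOn_of_hasDerivWithinAt_nonneg (convex_Icc 0 T)
      (hρ.curve.continuousOn_integral_comp_sub_curve hψ hz)
      (fun s hs => (hρ.hasDerivAt_integral_comp_sub hV hψ (by rwa [interior_Icc] at hs)
        (hz' s (by rwa [interior_Icc] at hs))).hasDerivWithinAt) fun s hs => ?_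
    rw [interior_Icc] at hs
    refine integral_nonneg_of_ae ?_
    filter_upwards [measure_eq_zero_iff_ae_notMem.1 (hR s (Ioo_subset_Icc_self hs))] with x hx
    have hx := (not_not.1 hx).1
    have hW : -(R + Z) ≤ x - z s := by linarith [hZ s (Ioo_subset_Icc_self hs)]
    by_cases hm : x - z s ∈ Icc 0 ε
    · exact mul_nonneg_of_nonpos_of_nonpos
        (sub_nonpos.2 (hvel s hs x ⟨by linarith [hm.1], by linarith [hm.2]⟩)) (hd _ hW)
    · simp [hd0 _ hW hm]
  have := (hρ.curve.mem 0 h0T).prob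
  have := (hρ.curve.mem t ht).prob
  exact (integral_comp_sub_mem_of_step (hR 0 h0T) (by linarith [hZ 0 h0T]) hψ h01 h1 h0).1.trans
    ((hmono h0T ht ht.1).trans
      (integral_comp_sub_mem_of_step (hR t ht) (by linarith [hZ t ht]) hψ h01 h1 h0).2)

/-- Mass does not cross from right to left a front that is slower than the velocity field. -/
lemma IsWeakSolution.real_Iic_le_of_ge (hV : IsNonlocalField (velocity v w) c C)
    (hρ : IsWeakSolution v w ρ₀ T ρ) (hε : 0 < ε) (hz : ContinuousOn z (Icc 0 T))
    (hz' : ∀ s ∈ Ioo 0 T, HasDerivAt z (z' s) s)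
    (hvel : ∀ s ∈ Ioo 0 T, ∀ x ∈ Icc (z s) (z s + ε), z' s ≤ velocity v w (ρ s) x)
    (ht : t ∈ Icc 0 T) : (ρ t).real (Iic (z t)) ≤ (ρ 0).real (Iic (z 0 + ε)) := by
  obtain ⟨R, hR⟩ := hρ.curve.exists_support
  obtain ⟨Z, hZ⟩ := exists_upper_bound_of_continuousOn_Icc hz
  obtain ⟨ψ, hψ, h01, h1, h0, hd, hd0⟩ := exists_step (W := R + Z) hε
  have h0T : (0 : ℝ) ∈ Icc 0 T := left_mem_Icc.2 (ht.1.trans ht.2)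
  have hanti : AntitoneOn (fun t => ∫ x, ψ (x - z t) ∂(ρ t)) (Icc 0 T) := by
    refine antitoneOn_of_hasDerivWithinAt_nonpos (convex_Icc 0 T)
      (hρ.curve.continuousOn_integral_comp_sub_curve hψ hz)
      (fun s hs => (hρ.hasDerivAt_integral_comp_sub hV hψ (by rwa [interior_Icc] at hs)
        (hz' s (by rwa [interior_Icc] at hs))).hasDerivWithinAt) fun s hs => ?_
    rw [interior_Icc] at hs
    refine integral_nonpos_of_ae ?_
    filter_upwards [measure_eq_zero_iff_ae_notMem.1 (hR s (Ioo_subset_Icc_self hs))] with x hx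
    have hx := (not_not.1 hx).1
    have hW : -(R + Z) ≤ x - z s := by linarith [hZ s (Ioo_subset_Icc_self hs)]
    by_cases hm : x - z s ∈ Icc 0 ε
    · exact mul_nonpos_of_nonneg_of_nonpos
        (sub_nonneg.2 (hvel s hs x ⟨by linarith [hm.1], by linarith [hm.2]⟩)) (hd _ hW)
    · simp [hd0 _ hW hm]
  have := (hρ.curve.mem 0 h0T).prob
  have := (hρ.curve.mem t ht).prob
  exact (integral_comp_sub_mem_of_step (hR t ht) (by linarith [hZ t ht]) hψ h01 h1 h0).1.trans
    ((hanti h0T ht ht.1).trans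
      (integral_comp_sub_mem_of_step (hR 0 h0T) (by linarith [hZ 0 h0T]) hψ h01 h1 h0).2)

end

/-! ### Uniqueness -/

section

variable {v w : ℝ → ℝ} {c C T κ a : ℝ} {ρ₀ : Measure ℝ} {ρ : ℝ → Measure ℝ}
  {X : ℝ → ℝ → ℝ}

lemma OrdBiLip.real_map_Iic {f : ℝ → ℝ} (hf : OrdBiLip κ f) (x : ℝ) :
    (ρ₀.map f).real (Iic (f x)) = ρ₀.real (Iic x) := by
  rw [map_measureReal_apply hf.measurable measurableSet_Iic]
  congr 1
  ext y
  exact hf.strictMono.le_iff_le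

/-- Displacements are at most `C * |t|`, so the intermediate value theorem applies. -/
lemma IsLagrangianSolution.surjective {V : Measure ℝ → ℝ → ℝ}
    (hX : IsLagrangianSolution V ρ₀ κ C T X) (t : ℝ) : Function.Surjective (X t) := fun y => by
  have h : ∀ x, |X t x - x| ≤ C * |t| := fun x => by
    simpa [hX.zero] using hX.lip 0 t x
  refine mem_range_of_exists_le_of_exists_ge (hX.ordBiLip t).continuous
    ⟨y - C * |t|, ?_⟩ ⟨y + C * |t|, ?_⟩
  · linarith [(abs_le.1 (h (y - C * |t|))).2]
  · linarith [(abs_le.1 (h (y + C * |t|))).1]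

variable [IsProbabilityMeasure ρ₀]

/-- Fronts at distance `r` from a trajectory of `X` are one-way for the mass of `ρ`. Only the
density bound `M` of `X # ρ₀` is used, never one for `ρ`. -/
lemma IsLagrangianSolution.abs_real_Iic_sub_le (hV : IsNonlocalField (velocity v w) c C)
    (ha : DensityLE a ρ₀) (hX : IsLagrangianSolution (velocity v w) ρ₀ κ C T X)
    (hρ : IsWeakSolution v w ρ₀ T ρ) {E η : ℝ} (hE : 0 ≤ E) (hη : 0 < η)
    (hbound : ∀ t ∈ Icc 0 T, ∀ y, |(ρ₀.map (X t)).real (Iic y) - (ρ t).real (Iic y)| ≤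
      E * Real.exp (3 * (c * (a * κ)) * t)) {t : ℝ} (ht : t ∈ Icc 0 T) (y : ℝ) :
    |(ρ₀.map (X t)).real (Iic y) - (ρ t).real (Iic y)| ≤
      (E / 2 + η) * Real.exp (3 * (c * (a * κ)) * t) := by
  have hκ := (hX.ordBiLip 0).pos
  set M := a * κ with hMdef
  have hM0 : 0 < M := mul_pos ha.pos hκ
  have hc := hV.nonneg
  have hprob : ∀ t, IsProbabilityMeasure (ρ₀.map (X t)) := fun t =>
    Measure.isProbabilityMeasure_map (hX.ordBiLip t).measurable.aemeasurable
  have hM : ∀ t, DensityLE M (ρ₀.map (X t)) := fun t => (hX.ordBiLip t).densityLE_map ha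
  set lam := 3 * (c * M) with hlam
  have hlam0 : 0 ≤ lam := by positivity
  -- With `M * r = (E + η) / 2 * exp (lam * s)` and `M * ε = η / 2`, the rate `r' = 3 * c * M * r`
  -- dominates the field error `c * M * (r + ε) + c * E * exp (lam * s)`, while `M * (r + ε)` stays
  -- below `(E / 2 + η) * exp (lam * s)`.
  set q := (E + η) / (2 * M) with hq
  have hq0 : 0 < q := by positivity
  set ε := η / (2 * M) with hεdef
  have hε : 0 < ε := by positivity
  have hMq : M * q = (E + η) / 2 := by rw [hq]; field_simp
  have hMε : M * ε = η / 2 := by rw [hεdef]; field_simp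
  set r : ℝ → ℝ := fun s => q * Real.exp (lam * s) with hr
  have hrd : ∀ s, HasDerivAt r (lam * r s) s := fun s => by
    refine ((((hasDerivAt_id s).const_mul lam).exp).const_mul q).congr_deriv ?_
    simp [hr]; ring
  have hexp : ∀ s ∈ Icc 0 T, 1 ≤ Real.exp (lam * s) := fun s hs =>
    Real.one_le_exp (mul_nonneg hlam0 hs.1)
  have hr0 : ∀ s, 0 < r s := fun s => by positivity
  have hXc : ∀ x, ContinuousOn (fun s => X s x) (Icc 0 T) := fun x =>
    (LipschitzWith.of_dist_le_mul (K := ⟨C, hV.nonneg_bound⟩) fun s t => by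
      rw [Real.dist_eq, Real.dist_eq]; exact hX.lip t s x).continuous.continuousOn
  have hrc : ContinuousOn r (Icc 0 T) := fun s _ => (hrd s).continuousAt.continuousWithinAt
  have hfield : ∀ s ∈ Icc 0 T, ∀ x z, |z - X s x| ≤ r s + ε →
      |velocity v w (ρ₀.map (X s)) (X s x) - velocity v w (ρ s) z| ≤ lam * r s := by
    intro s hs x z hz
    have hb := hρ.curve.mem s hs
    have := hb.prob
    have h1 := hV.abs_sub_le (hM s) (X s x) z
    have h2 := hV.lip _ _ (hM s).absolutelyContinuous hb.ac z z _ fun y =>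
      hbound s hs (y + z)
    rw [abs_sub_comm] at hz
    have h3 : c * (M * |X s x - z|) ≤ c * (M * (r s + ε)) := by gcongr
    have h4 : c * (M * (r s + ε)) + c * (E * Real.exp (lam * s)) ≤ lam * r s := by
      have h5 : M * r s = (E + η) / 2 * Real.exp (lam * s) := by
        simp only [hr]; rw [← mul_assoc, hMq]
      have h6 : lam * r s = 3 * c * (M * r s) := by rw [hlam]; ring
      rw [h6, mul_add, h5, hMε]
      have h7 : c * η ≤ c * η * Real.exp (lam * s) :=
        le_mul_of_one_le_right (by positivity) (hexp s hs)
      nlinarith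
    exact (_root_.abs_sub_le _ (velocity v w (ρ₀.map (X s)) z) _).trans (by linarith)
  have hzero : ∀ x, X 0 x = x := hX.zero
  have hup : ∀ x, ρ₀.real (Iic x) ≤ (ρ t).real (Iic (X t x + r t + ε)) := fun x => by
    have h1 := hρ.real_Iic_le_of_le hV hε (z := fun s => X s x + r s) ((hXc x).add hrc)
      (fun s hs => (hX.hasDerivAt s hs x).add (hrd s)) (fun s hs z hz => by
        have h2 := abs_le.1 (hfield s (Ioo_subset_Icc_self hs) x z (by
          rw [abs_le]; constructor <;> linarith [hz.1, hz.2, hr0 s]))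
        linarith [h2.1]) ht
    refine le_trans ?_ h1
    rw [hρ.init, hzero]
    exact measureReal_mono (Iic_subset_Iic.2 (by linarith [hr0 0]))
  have hlow : ∀ x, (ρ t).real (Iic (X t x - r t - ε)) ≤ ρ₀.real (Iic x) := fun x => by
    have h1 := hρ.real_Iic_le_of_ge hV hε (z := fun s => X s x - r s - ε)
      (((hXc x).sub hrc).sub continuousOn_const)
      (fun s hs => ((hX.hasDerivAt s hs x).sub (hrd s)).sub_const ε) (fun s hs z hz => by
        have h2 := abs_le.1 (hfield s (Ioo_subset_Icc_self hs) x z (by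
          rw [abs_le]; constructor <;> linarith [hz.1, hz.2, hr0 s]))
        linarith [h2.2]) ht
    refine h1.trans ?_
    rw [hρ.init, hzero]
    exact measureReal_mono (Iic_subset_Iic.2 (by linarith [hr0 0]))
  have hMr : M * (r t + ε) ≤ (E / 2 + η) * Real.exp (lam * t) := by
    have h1 : M * r t = (E + η) / 2 * Real.exp (lam * t) := by
      simp only [hr]; rw [← mul_assoc, hMq]
    rw [mul_add, h1, hMε]
    have h7 : η ≤ η * Real.exp (lam * t) := le_mul_of_one_le_right hη.le (hexp t ht)
    linarith
  have hd := hr0 t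
  rw [abs_le]
  constructor
  · obtain ⟨x, hx⟩ := hX.surjective t (y + r t + ε)
    have h1 := hlow x
    rw [← (hX.ordBiLip t).real_map_Iic x, hx, show y + r t + ε - r t - ε = y by ring] at h1
    have h2 := (hM t).real_Iic_le hM0.le (show y ≤ y + r t + ε by linarith)
    rw [show y + r t + ε - y = r t + ε by ring] at h2
    linarith
  · obtain ⟨x, hx⟩ := hX.surjective t (y - r t - ε)
    have h1 := hup x
    rw [← (hX.ordBiLip t).real_map_Iic x, hx, show y - r t - ε + r t + ε = y by ring] at h1
    have h2 := (hM t).real_Iic_le hM0.le (show y - r t - ε ≤ y by linarith)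
    rw [show y - (y - r t - ε) = r t + ε by ring] at h2
    linarith

/-- The bootstrap starts from the trivial distance `1` between distribution functions, ends at a
multiple of `η`, and `η` tends to `0`. -/
lemma IsLagrangianSolution.eq_map (hV : IsNonlocalField (velocity v w) c C)
    (ha : DensityLE a ρ₀) (hX : IsLagrangianSolution (velocity v w) ρ₀ κ C T X)
    (hρ : IsWeakSolution v w ρ₀ T ρ) {t : ℝ} (ht : t ∈ Icc 0 T) : ρ t = ρ₀.map (X t) := by
  have hprob : ∀ t, IsProbabilityMeasure (ρ₀.map (X t)) := fun t =>
    Measure.isProbabilityMeasure_map (hX.ordBiLip t).measurable.aemeasurable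
  have := (hρ.curve.mem t ht).prob
  have hlam : 0 ≤ 3 * (c * (a * κ)) :=
    mul_nonneg (by norm_num) (mul_nonneg hV.nonneg (mul_pos ha.pos (hX.ordBiLip 0).pos).le)
  refine Measure.ext_of_Iic _ _ fun y => ?_
  have main : ∀ η, 0 < η → |(ρ₀.map (X t)).real (Iic y) - (ρ t).real (Iic y)| ≤
      2 * η * Real.exp (3 * (c * (a * κ)) * t) := fun η hη =>
    le_of_forall_half_add (ι := Icc 0 T × ℝ)
      (f := fun p => |(ρ₀.map (X p.1)).real (Iic p.2) - (ρ p.1).real (Iic p.2)|)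
      (g := fun p => Real.exp (3 * (c * (a * κ)) * p.1)) (fun _ => (Real.exp_pos _).le)
      zero_le_one hη.le (fun ⟨⟨s, hs⟩, y⟩ => by
        have := (hρ.curve.mem s hs).prob
        have h1 : |(ρ₀.map (X s)).real (Iic y) - (ρ s).real (Iic y)| ≤ 1 :=
          abs_sub_le_of_nonneg_of_le measureReal_nonneg measureReal_le_one measureReal_nonneg
            measureReal_le_one
        rw [one_mul]
        exact h1.trans (Real.one_le_exp (mul_nonneg hlam hs.1)))
      (fun E hE h ⟨⟨s, hs⟩, y⟩ => hX.abs_real_Iic_sub_le hV ha hρ hE hη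
        (fun s hs y => h (⟨s, hs⟩, y)) hs y) (⟨t, ht⟩, y)
  have hlim : Tendsto (fun η => 2 * η * Real.exp (3 * (c * (a * κ)) * t)) (𝓝[>] 0)
      (𝓝 (2 * 0 * Real.exp (3 * (c * (a * κ)) * t))) :=
    (Continuous.tendsto (by fun_prop) 0).mono_left nhdsWithin_le_nhds
  rw [mul_zero, zero_mul] at hlim
  have h0 := ge_of_tendsto hlim (eventually_mem_nhdsWithin.mono main)
  have h1 := sub_eq_zero.1 (abs_nonpos_iff.1 h0)
  exact ((measureReal_eq_measureReal_iff).1 h1).symm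

end

/-! ### Well-posedness -/

lemma existsUnique_and_euler {v w : ℝ → ℝ} {c C T : ℝ} {ρ₀ : Measure ℝ}
    (hV : IsNonlocalField (velocity v w) c C) (hρ₀ : IsBddDensity ρ₀) (hT : 0 < T)
    (hcT : c * (linfNorm ρ₀).toReal * T < 1) :
    ExistsUniqueWeakSolution v w ρ₀ T ∧
      ∃ r : ℕ → ℝ → Measure ℝ, (∀ n, IsEulerTrajectory v w ρ₀ T n (r n) ∧ IsContCurve T (r n)) ∧
        ∃ ρ : ℝ → Measure ℝ, IsWeakSolution v w ρ₀ T ρ ∧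
          Tendsto (fun n => ⨆ t ∈ Icc 0 T, Winf (r n t) (ρ t)) atTop (𝓝 0) := by
  have := hρ₀.prob
  have ha := hρ₀.densityLE
  have hh : ∀ n : ℕ, 0 < T / 2 ^ n := fun n => by positivity
  have hh0 : Tendsto (fun n : ℕ => T / 2 ^ n) atTop (𝓝 0) :=
    tendsto_const_nhds.div_atTop (tendsto_pow_atTop_atTop_of_one_lt one_lt_two)
  have hE := fun n => isApproxFlow_eulerMap hV ha hcT (hh n)
  obtain ⟨X, hX, B, hBX⟩ := exists_isLagrangianSolution hV ha hT.le (fun n => (hh n).le) hh0 hE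
  have hweak := hX.isWeakSolution hV hρ₀ hT.le
  refine ⟨⟨⟨_, hweak⟩, fun ρ ρ' hρ hρ' t ht =>
    (hX.eq_map hV ha hρ ht).trans (hX.eq_map hV ha hρ' ht).symm⟩, _, fun n =>
      ⟨isEulerTrajectory_eulerMap hV ha hT hcT n,
        isContCurve_map hρ₀ (hE n).ordBiLip (hE n).lip⟩, _, hweak, ?_⟩
  have hlim : Tendsto (fun n : ℕ => ENNReal.ofReal (B * (T / 2 ^ n))) atTop (𝓝 0) := by
    have := (ENNReal.continuous_ofReal.tendsto _).comp (hh0.const_mul B)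
    rwa [mul_zero, ENNReal.ofReal_zero] at this
  refine tendsto_of_tendsto_of_tendsto_of_le_of_le tendsto_const_nhds hlim
    (fun _ => zero_le) fun n => iSup₂_le fun t ht => ?_
  exact Winf_map_le ((hE n).ordBiLip t ht).measurable (hX.ordBiLip t).measurable (hBX n t ht)

end NonlocalTransport

theorem mainTheorem3 (v w : ℝ → ℝ) (L : ℝ≥0) (α β : ℝ) (ρ₀ : Measure ℝ)
    (hv : LipschitzOnWith L v (Ici 0))
    (hvb : ∃ C : ℝ, ∀ s ∈ Ici (0 : ℝ), |v s| ≤ C)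
    (hw_bv : BoundedVariationOn w (Icc α β))
    (hw_nonneg : ∀ x, 0 ≤ w x)
    (hw_zero : ∀ x, x ∉ Icc α β → w x = 0)
    (hw_int : ∫ x in Icc α β, w x = 1)
    (hρ₀ : NonlocalTransport.IsBddDensity ρ₀) :
    (∃ T : ℝ, 0 < T ∧ ∀ t ∈ Ioo 0 T,
      NonlocalTransport.ExistsUniqueWeakSolution v w ρ₀ t) ∧
    ∀ T : ℝ, 0 < T →
      T * (Real.exp 1 * L * (eVariationOn w univ).toReal *
        (NonlocalTransport.linfNorm ρ₀).toReal) < 1 →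
      NonlocalTransport.ExistsUniqueWeakSolution v w ρ₀ T ∧
      ∃ r : ℕ → ℝ → Measure ℝ,
        (∀ n, NonlocalTransport.IsEulerTrajectory v w ρ₀ T n (r n) ∧
          NonlocalTransport.IsContCurve T (r n)) ∧
        ∃ (ρ : ℝ → Measure ℝ) (σ : ℕ → ℕ), StrictMono σ ∧
          NonlocalTransport.IsWeakSolution v w ρ₀ T ρ ∧
          Tendsto (fun n => ⨆ t ∈ Icc 0 T, NonlocalTransport.Winf (r (σ n) t) (ρ t))
            atTop (𝓝 0) := by
  obtain ⟨C, hC⟩ := hvb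
  -- An empty interval would give integral `0` instead of `1`.
  have hαβ : α ≤ β := by
    by_contra! h
    simp [Icc_eq_empty (not_le.2 h)] at hw_int
  have hV := NonlocalTransport.isNonlocalField_velocity hv hC
    (NonlocalTransport.boundedVariationOn_univ hw_bv hw_nonneg hw_zero hαβ) hw_nonneg hw_zero
  set c := L * (eVariationOn w univ).toReal with hc
  set a := (NonlocalTransport.linfNorm ρ₀).toReal
  have hca : 0 ≤ c * a := mul_nonneg hV.nonneg ENNReal.toReal_nonneg
  -- The added `1` keeps this time finite and positive when `c * a = 0`.
  refine ⟨⟨(c * a + 1)⁻¹, by positivity, fun t ht => ?_⟩, fun T hT hTc => ?_⟩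
  · refine (NonlocalTransport.existsUnique_and_euler hV hρ₀ ht.1 ?_).1
    have h1 : t * (c * a + 1) < 1 := (lt_inv_mul_iff₀' (by positivity)).1 (by simpa using ht.2)
    nlinarith [ht.1]
  · have h1 : c * a * T < 1 := by
      -- The factor `e ≥ 1` can be dropped: `c * a * T < 1` suffices.
      refine lt_of_le_of_lt ?_ hTc
      have h2 : 1 ≤ Real.exp 1 := Real.one_le_exp zero_le_one
      calc c * a * T ≤ Real.exp 1 * (c * a * T) :=
            le_mul_of_one_le_left (mul_nonneg hca hT.le) h2
        _ = _ := by rw [hc]; ring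
    obtain ⟨h2, r, hr, ρ, hρ, hlim⟩ := NonlocalTransport.existsUnique_and_euler hV hρ₀ hT h1
    -- The whole sequence converges, so the subsequence is the identity.
    exact ⟨h2, r, hr, ρ, id, strictMono_id, hρ, hlim⟩
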